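/- Let $(g_n)_{n\ge 0}$ be independent standard complex-valued Gaussian random variables on a probability space (real and imaginary parts independent, centred, of variance $\tfrac12$). Let $\mathbb T=\mathbb R/2\pi\mathbb Z$, $\widehat f(n)=\frac1{2\pi}\int_{\mathbb T}f(x)e^{-inx}\,dx$, and for $\alpha>\tfrac12$ put $$u_0=u_0^\omega=\sum_{n\ge 0}\frac{g_n(\omega)}{\sqrt{1+|n|^{2\alpha}}}\,e^{inx}.$$ For $s\in\mathbb R$ let $\|f\|_{H^s}=\big(\sum_{n\in\mathbb Z}(1+|n|)^{2s}|\widehat f(n)|^2\big)^{1/2}\in[0,\infty]$, let $\Pi f=\sum_{n\ge 0}\widehat f(n)e^{inx}$ be the Szegő projector, $H^s_+=\Pi(H^s)$, and $\|v\|_{C([-T,T];H^s_+)}=\sup_{|t|\le T}\|v(t)\|_{H^s}$. For the cubic Szegő equation $iu_t=\Pi(|u|^2u)$, $u|_{t=0}=u_0$, let $$\mathcal N(u_1,u_2,u_3)(t)=\int_0^t\Pi(u_1\overline{u_2}u_3)(t')\,dt',\qquad z(t)=u_0-i\,\mathcal N(u_0,u_0,u_0)(t),$$ $z$ being the second iterate.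 For every $\alpha>\tfrac12$, almost surely the series for $u_0$ converges in $L^2(\mathbb T)$ and $|u_0|^2u_0\in L^1(\mathbb T)$, so that these objects are well defined. Moreover: (a) Let $\alpha\in(\tfrac12,1]$ and $s\ge\alpha-\tfrac12$. Then almost surely, for every $T>0$, $$\|\mathcal N(u_0,u_0,u_0)\|_{C([-T,T];H^s_+)}=\infty .$$ Also, for every such $\alpha$ (even $\alpha=1$) the second iterate is a.s. unbounded in $H^{1/2}_+$: almost surely $\|z\|_{C([-T,T];H^{1/2}_+)}=\infty$ for every $T>0$, and for each fixed $t\in\mathbb R$, $\|z(t)\|_{H^{1/2}}=\infty$ almost surely. (b) Let $\alpha>\tfrac12$, $\varepsilon>0$ and $s<\alpha-\tfrac12-\varepsilon$. Then the second iterate is a.s. bounded in $H^s_+$: almost surely, for every $T>0$, $z(t)\in H^s_+$ for all $t\in[-T,T]$ and $\|z\|_{C([-T,T];H^s_+)}<\infty$. -/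

import Mathlib

open MeasureTheory ProbabilityTheory
open scoped NNReal ENNReal ComplexConjugate

noncomputable section

namespace Szego

instance instTwoPiPos : Fact (0 < 2 * Real.pi) := ⟨Real.two_pi_pos⟩

/-- The torus `ℝ / 2πℤ`. Its monomial `fourier n` is `x ↦ exp (i n x)`, and `fourierCoeff f n` is
`(1 / 2π) ∫ f(x) exp (- i n x) dx`. -/
abbrev Torus : Type := AddCircle (2 * Real.pi)

/-- A complex random variable is standard complex Gaussian when its real and imaginary parts are
independent real Gaussians with mean `0` and variance `1/2` (so that `E|X|² = 1`). -/
structure IsStdComplexGaussian {Ω : Type*} [MeasurableSpace Ω] (X : Ω → ℂ) (P : Measure Ω) :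
    Prop where
  measurable : Measurable X
  law_re : HasLaw (fun ω => (X ω).re) (gaussianReal 0 (1 / 2)) P
  law_im : HasLaw (fun ω => (X ω).im) (gaussianReal 0 (1 / 2)) P
  indep : IndepFun (fun ω => (X ω).re) (fun ω => (X ω).im) P

/-- The `n`-th term `g_n / √(1 + |n|^(2α)) e^{inx}`, `n ≥ 0`, of the random series, as an element
of `L²` of the torus. -/
def randomTerm (α : ℝ) (γ : ℕ → ℂ) (n : ℕ) :
    Lp ℂ 2 (AddCircle.haarAddCircle : Measure Torus) :=
  (γ n / (Real.sqrt (1 + (n : ℝ) ^ (2 * α)) : ℂ)) • fourierLp 2 (n : ℤ)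

/-- The initial datum `u₀ = ∑_{n ≥ 0} g_n / √(1 + |n|^(2α)) e^{inx}` for the realization
`γ = (g_n(ω))_n`, the series being summed in `L²` of the torus. -/
def initialDatum (α : ℝ) (γ : ℕ → ℂ) : Lp ℂ 2 (AddCircle.haarAddCircle : Measure Torus) :=
  ∑' n : ℕ, randomTerm α γ n

/-- The pointwise product `u₁ ū₂ u₃`. -/
def tripleProduct (u₁ u₂ u₃ : Torus → ℂ) : Torus → ℂ :=
  fun x => u₁ x * conj (u₂ x) * u₃ x

/-- The Szegő projector onto the non-negative frequencies. Distributions on the torus are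
represented by their Fourier coefficients `ℤ → ℂ`. -/
def szegoProjector (c : ℤ → ℂ) : ℤ → ℂ := fun n => if 0 ≤ n then c n else 0

/-- The norm `‖(1 + |n|)^s f̂(n)‖_{ℓ²}` of `H^s` of the torus, with value `∞` off `H^s`, for the
distribution with Fourier coefficients `c`. -/
def sobolevNorm (s : ℝ) (c : ℤ → ℂ) : ℝ≥0∞ :=
  (∑' n : ℤ, (ENNReal.ofReal ((1 + |(n : ℝ)|) ^ s) * ‖c n‖ₑ) ^ 2) ^ (1 / 2 : ℝ)

/-- Membership in `H^s_+ = Π(H^s)`: the elements of `H^s` with no negative frequencies. -/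
def MemSobolevPlus (s : ℝ) (c : ℤ → ℂ) : Prop :=
  (∀ n : ℤ, n < 0 → c n = 0) ∧ sobolevNorm s c < ∞

/-- The norm of `C([-T, T]; H^s)`: the supremum over `t ∈ [-T, T]` of the `H^s` norm. -/
def supSobolevNorm (T s : ℝ) (v : ℝ → ℤ → ℂ) : ℝ≥0∞ :=
  ⨆ t ∈ Set.Icc (-T) T, sobolevNorm s (v t)

/-- The Duhamel operator `𝒩(u₁, u₂, u₃)(t) = ∫₀ᵗ Π(u₁ ū₂ u₃)(t') dt'`, through the Fourier
coefficients of its value at time `t`. -/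
def duhamel (u₁ u₂ u₃ : ℝ → Torus → ℂ) (t : ℝ) : ℤ → ℂ :=
  fun n => ∫ t' in (0 : ℝ)..t,
    szegoProjector (fourierCoeff (tripleProduct (u₁ t') (u₂ t') (u₃ t'))) n

/-- `𝒩(u₀, u₀, u₀)(t)`, with `u₀` regarded as a function of `(t, x)` that is constant in `t`. -/
def duhamelOfData (u₀ : Torus → ℂ) : ℝ → ℤ → ℂ :=
  duhamel (fun _ => u₀) (fun _ => u₀) (fun _ => u₀)

/-- The second iterate `z(t) = u₀ - i 𝒩(u₀, u₀, u₀)(t)`, through its Fourier coefficients. -/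
def secondIterate (u₀ : Torus → ℂ) (t : ℝ) : ℤ → ℂ :=
  fun n => fourierCoeff u₀ n - Complex.I * duhamelOfData u₀ t n

end Szego

end

/-! The datum does not depend on time, so `𝒩(u₀, u₀, u₀)(t) = t v` with `v = Π(|u₀|² u₀)`, and
everything reduces to the Fourier coefficients of `u₀` and `v`. The work is done on `ℕ → ℂ` with the
product law `gaussianSequence`; `map_eq_gaussianSequence` transports the results to the given
variables.

Upper bound. It suffices that `E|v̂(n)|² ≤ C / (1 + n^(2α))`, the order of `E|û₀(n)|²`, since then
`∑ (1 + n)^(2s) E|v̂(n)|²` converges for `s < α - 1/2`. Formally `v̂(n)` is the sum of `a_k ā_l a_m`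
over `k - l + m = n`, with `a = û₀`. The resonant terms, `l = k` or `l = m`, contribute at most `2
|a_n| ∑ |a_k|²`. The others are uncorrelated up to exchanging `k` and `m`: the law is invariant
under multiplying one coordinate by `i`, so a monomial whose charge in some coordinate is not
divisible by 4 has mean zero. Since `k + m ≥ n`, one of `k`, `m` is at least `n / 2` and supplies
the decay; the other two variances are summed, which uses `α > 1/2`. The bound is uniform in the
truncation (`exists_lintegral_enorm_cubicSum_sq_le`) and survives the limit by Fatou, because along
a subsequence the partial sums converge almost surely in `L⁴`, where the cubic coefficients are
continuous.

Divergence. No lower bound on moments of `v̂(n)` is needed. Freeze every variable except `x = Re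
g_0`, so that `u₀ = h + x` with `h` fixed. For `n ≥ 1` the `n`-th coefficient of `b u₀ + c v` is a
quadratic polynomial in `x` with leading coefficient `2 c û₀(n)`. If three values of `x` gave finite
`H^(α - 1/2)` norm, a divided difference would put `u₀` minus its mean in that space, whereas `∑
|g_n|² / (n + 1) = ∞` almost surely by the strong law. So at most two values of `x` are exceptional,
and Fubini with the absence of atoms concludes (`ae_energy_linearCombination_eq_top`). -/

noncomputable section

namespace Szego

/-! ### Gaussian laws, quarter turns and charges -/

/-- The law of a standard complex Gaussian variable. -/
def stdComplexGaussian : Measure ℂ :=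
  ((gaussianReal 0 (1 / 2)).prod (gaussianReal 0 (1 / 2))).map fun p => (p.1 : ℂ) + p.2 * Complex.I

instance : IsProbabilityMeasure stdComplexGaussian :=
  Measure.isProbabilityMeasure_map (by fun_prop)

lemma IsStdComplexGaussian.map_eq {Ω : Type*} [MeasurableSpace Ω] {P : Measure Ω}
    [IsProbabilityMeasure P] {X : Ω → ℂ} (hX : IsStdComplexGaussian X P) :
    P.map X = stdComplexGaussian := by
  have h := (indepFun_iff_map_prod_eq_prod_map_map hX.law_re.aemeasurable
    hX.law_im.aemeasurable).1 hX.indep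
  rw [hX.law_re.map_eq, hX.law_im.map_eq] at h
  rw [stdComplexGaussian, ← h, AEMeasurable.map_map_of_aemeasurable (by fun_prop)
    (hX.law_re.aemeasurable.prodMk hX.law_im.aemeasurable)]
  congr 1
  ext ω
  simp [Complex.re_add_im]

/-- Multiplication by `i` is `(x, y) ↦ (-y, x)`, a swap of two identically distributed factors
followed by a reflection of a symmetric law. -/
lemma map_I_mul_stdComplexGaussian :
    stdComplexGaussian.map (fun z => Complex.I * z) = stdComplexGaussian := by
  have h1 : ((gaussianReal 0 (1 / 2)).prod (gaussianReal 0 (1 / 2))).map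
      (fun p : ℝ × ℝ => (-p.2, p.1)) = (gaussianReal 0 (1 / 2)).prod (gaussianReal 0 (1 / 2)) := by
    have h2 : (fun p : ℝ × ℝ => (-p.2, p.1)) = Prod.map (fun x => -x) id ∘ Prod.swap := by
      ext p <;> simp
    rw [h2, ← Measure.map_map (by fun_prop) (by fun_prop), Measure.prod_swap,
      ← Measure.map_prod_map _ _ (by fun_prop) (by fun_prop), gaussianReal_map_neg, neg_zero,
      Measure.map_id]
  conv_rhs => rw [stdComplexGaussian, ← h1]
  rw [stdComplexGaussian, Measure.map_map (by fun_prop) (by fun_prop),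
    Measure.map_map (by fun_prop) (by fun_prop)]
  congr 1
  ext p
  simp only [Function.comp]
  push_cast
  linear_combination (p.2 : ℂ) * Complex.I_mul_I

lemma memLp_id_stdComplexGaussian (p : ℝ≥0) : MemLp id p stdComplexGaussian := by
  rw [stdComplexGaussian, memLp_map_measure_iff (by fun_prop) (by fun_prop)]
  have h := memLp_id_gaussianReal (μ := 0) (v := 1 / 2) p
  have h1 := (h.comp_fst (gaussianReal 0 (1 / 2))).ofReal (K := ℂ)
  have h2 := (h.comp_snd (gaussianReal 0 (1 / 2))).ofReal (K := ℂ)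
  exact h1.add (h2.mul_const Complex.I)

/-- The law of a sequence of independent standard complex Gaussian variables. -/
def gaussianSequence : Measure (ℕ → ℂ) := Measure.infinitePi fun _ => stdComplexGaussian

instance : IsProbabilityMeasure gaussianSequence := by
  unfold gaussianSequence; infer_instance

lemma map_eq_gaussianSequence {Ω : Type*} [MeasurableSpace Ω] {P : Measure Ω}
    [IsProbabilityMeasure P] {g : ℕ → Ω → ℂ} (hg : ∀ n, IsStdComplexGaussian (g n) P)
    (hind : iIndepFun g P) : P.map (fun ω n => g n ω) = gaussianSequence := by
  rw [hind.map_fun_eq_infinitePi_map fun n => (hg n).measurable, gaussianSequence]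
  simp_rw [fun n => (hg n).map_eq]

lemma measurePreserving_eval_gaussianSequence (n : ℕ) :
    MeasurePreserving (fun γ : ℕ → ℂ => γ n) gaussianSequence stdComplexGaussian :=
  ⟨by fun_prop, Measure.infinitePi_map_eval _ n⟩

lemma memLp_eval_gaussianSequence (p : ℝ≥0) (n : ℕ) :
    MemLp (fun γ : ℕ → ℂ => γ n) p gaussianSequence :=
  (memLp_id_stdComplexGaussian p).comp_measurePreserving (measurePreserving_eval_gaussianSequence n)

/-- Rotation of the `k`-th coordinate by a right angle. -/
def rotate (k : ℕ) (γ : ℕ → ℂ) : ℕ → ℂ := fun n => Complex.I ^ (if n = k then 1 else 0 : ℤ) * γ n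

lemma measurable_rotate (k : ℕ) : Measurable (rotate k) := by
  unfold rotate; fun_prop

lemma measurePreserving_rotate (k : ℕ) :
    MeasurePreserving (rotate k) gaussianSequence gaussianSequence := by
  refine ⟨measurable_rotate k, ?_⟩
  have h := Measure.infinitePi_map_pi (μ := fun _ : ℕ => stdComplexGaussian)
    (f := fun n z => Complex.I ^ (if n = k then 1 else 0 : ℤ) * z) (fun n => by fun_prop)
  refine Eq.trans h ?_
  unfold gaussianSequence
  congr 1
  ext1 n
  by_cases hn : n = k
  · simpa [hn] using map_I_mul_stdComplexGaussian
  · simp [hn]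

lemma I_zpow_ne_one {d : ℤ} (hd : ¬ 4 ∣ d) : Complex.I ^ d ≠ 1 := by
  have h := Int.emod_add_mul_ediv d 4
  rw [← h, zpow_add₀ Complex.I_ne_zero, zpow_mul]
  have h4 : Complex.I ^ (4 : ℤ) = 1 := by exact_mod_cast Complex.I_pow_four
  rw [h4, one_zpow, mul_one]
  have h1 : 0 ≤ d % 4 := by omega
  have h2 : d % 4 < 4 := by omega
  have h3 : d % 4 ≠ 0 := by omega
  interval_cases d % 4
  · exact absurd rfl h3
  · simp [Complex.ext_iff]
  · rw [show (2 : ℤ) = ((2 : ℕ) : ℤ) from rfl, zpow_natCast, Complex.I_sq]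
    norm_num
  · rw [show (3 : ℤ) = ((3 : ℕ) : ℤ) from rfl, zpow_natCast, Complex.I_pow_three]
    simp [Complex.ext_iff]

/-- `Z` has charge `d`: rotating the `k`-th coordinate by `i` multiplies `Z` by `i ^ d k`. -/
def HasCharge (Z : (ℕ → ℂ) → ℂ) (d : ℕ → ℤ) : Prop :=
  ∀ k γ, Z (rotate k γ) = Complex.I ^ d k * Z γ

lemma hasCharge_eval (n : ℕ) : HasCharge (fun γ => γ n) (fun k => if n = k then 1 else 0) :=
  fun _ _ => rfl

lemma HasCharge.mul {Z W : (ℕ → ℂ) → ℂ} {d e : ℕ → ℤ} (hZ : HasCharge Z d) (hW : HasCharge W e) :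
    HasCharge (fun γ => Z γ * W γ) (fun k => d k + e k) := fun k γ => by
  simp only [hZ k γ, hW k γ, zpow_add₀ Complex.I_ne_zero]
  ring

lemma HasCharge.conj {Z : (ℕ → ℂ) → ℂ} {d : ℕ → ℤ} (hZ : HasCharge Z d) :
    HasCharge (fun γ => conj (Z γ)) (fun k => - d k) := fun k γ => by
  simp only [hZ k γ, map_mul, map_zpow₀, Complex.conj_I, ← Complex.inv_I, inv_zpow, zpow_neg]

lemma HasCharge.const_mul {Z : (ℕ → ℂ) → ℂ} {d : ℕ → ℤ} (hZ : HasCharge Z d) (c : ℂ) :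
    HasCharge (fun γ => c * Z γ) d := fun k γ => by
  simp only [hZ k γ]
  ring

/-- Invariance of the law under the rotation gives `E Z = i ^ d k * E Z`. Quarter turns see charges
only modulo 4; this is enough below, where charges have absolute value at most 3. -/
lemma HasCharge.integral_eq_zero {Z : (ℕ → ℂ) → ℂ} {d : ℕ → ℤ} (hZ : HasCharge Z d)
    (hm : AEStronglyMeasurable Z gaussianSequence) {k : ℕ} (hk : ¬ 4 ∣ d k) :
    ∫ γ, Z γ ∂gaussianSequence = 0 := by
  have h1 : ∫ γ, Z γ ∂gaussianSequence = Complex.I ^ d k * ∫ γ, Z γ ∂gaussianSequence := by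
    conv_lhs => rw [← (measurePreserving_rotate k).map_eq]
    rw [integral_map (measurable_rotate k).aemeasurable
      (by rwa [(measurePreserving_rotate k).map_eq])]
    simp_rw [fun γ => hZ k γ]
    exact integral_const_mul _ _
  have h2 : (1 - Complex.I ^ d k) * ∫ γ, Z γ ∂gaussianSequence = 0 := by
    linear_combination h1
  exact (mul_eq_zero.1 h2).resolve_left (sub_ne_zero.2 (I_zpow_ne_one hk).symm)

/-! ### Almost orthogonality, moments and the strong law -/

/-- If each member of a finite family is correlated with at most `m` of its members, then the
second moment of the sum is at most `m` times the sum of the second moments. -/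
lemma integral_norm_sq_sum_le {Ω ι : Type*} [MeasurableSpace Ω] {P : Measure Ω} (S : Finset ι)
    (Z : ι → Ω → ℂ) (hZ : ∀ i ∈ S, MemLp (Z i) 2 P) (r : ι → ι → Prop) [DecidableRel r]
    (hsymm : ∀ i j, r i j → r j i)
    (horth : ∀ i ∈ S, ∀ j ∈ S, ¬ r i j → ∫ ω, Z i ω * conj (Z j ω) ∂P = 0) (m : ℕ)
    (hcard : ∀ i ∈ S, (S.filter (r i)).card ≤ m) :
    ∫ ω, ‖∑ i ∈ S, Z i ω‖ ^ 2 ∂P ≤ m * ∑ i ∈ S, ∫ ω, ‖Z i ω‖ ^ 2 ∂P := by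
  have hsq : ∀ i ∈ S, Integrable (fun ω => ‖Z i ω‖ ^ 2) P := fun i hi =>
    (hZ i hi).integrable_norm_pow two_ne_zero
  have hint : ∀ i ∈ S, ∀ j ∈ S, Integrable (fun ω => Z i ω * conj (Z j ω)) P := fun i hi j hj =>
    (hZ i hi).integrable_mul (hZ j hj).star
  have h1 : ((∫ ω, ‖∑ i ∈ S, Z i ω‖ ^ 2 ∂P : ℝ) : ℂ) =
      ∑ i ∈ S, ∑ j ∈ S, ∫ ω, Z i ω * conj (Z j ω) ∂P := by
    rw [← integral_complex_ofReal]
    simp_rw [Complex.ofReal_pow, ← Complex.mul_conj', map_sum, Finset.sum_mul_sum]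
    rw [integral_finsetSum _ fun i hi => integrable_finsetSum _ fun j hj => hint i hi j hj]
    exact Finset.sum_congr rfl fun i hi => integral_finsetSum _ fun j hj => hint i hi j hj
  have h2 : ∫ ω, ‖∑ i ∈ S, Z i ω‖ ^ 2 ∂P ≤
      ∑ i ∈ S, ∑ j ∈ S, ‖∫ ω, Z i ω * conj (Z j ω) ∂P‖ := by
    calc ∫ ω, ‖∑ i ∈ S, Z i ω‖ ^ 2 ∂P ≤ ‖((∫ ω, ‖∑ i ∈ S, Z i ω‖ ^ 2 ∂P : ℝ) : ℂ)‖ := by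
          rw [Complex.norm_real]; exact Real.le_norm_self _
      _ ≤ _ := by
          rw [h1]
          exact (norm_sum_le _ _).trans (Finset.sum_le_sum fun i _ => norm_sum_le _ _)
  -- As in the Schur test: `|z w̄| ≤ (|z|² + |w|²) / 2`, and by symmetry of `r` both halves give the
  -- same double sum, so only row counts matter.
  have h3 : ∀ i ∈ S, ∀ j ∈ S, ‖∫ ω, Z i ω * conj (Z j ω) ∂P‖ ≤
      if r i j then ((∫ ω, ‖Z i ω‖ ^ 2 ∂P) + ∫ ω, ‖Z j ω‖ ^ 2 ∂P) / 2 else 0 := by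
    intro i hi j hj
    split_ifs with h
    · rw [← integral_add (hsq i hi) (hsq j hj), ← integral_div]
      refine (norm_integral_le_integral_norm _).trans (integral_mono (hint i hi j hj).norm
        (((hsq i hi).add (hsq j hj)).div_const 2) fun ω => ?_)
      simp only [norm_mul, RCLike.norm_conj]
      nlinarith [sq_nonneg (‖Z i ω‖ - ‖Z j ω‖)]
    · rw [horth i hi j hj h, norm_zero]
  have h4 : ∀ i ∈ S, (∑ j ∈ S, if r i j then ∫ ω, ‖Z i ω‖ ^ 2 ∂P else 0) ≤
      m * ∫ ω, ‖Z i ω‖ ^ 2 ∂P := by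
    intro i hi
    rw [← Finset.sum_filter, Finset.sum_const, nsmul_eq_mul]
    gcongr
    exact hcard i hi
  have h5 : (∑ i ∈ S, ∑ j ∈ S, if r i j then ∫ ω, ‖Z j ω‖ ^ 2 ∂P else 0) =
      ∑ i ∈ S, ∑ j ∈ S, if r i j then ∫ ω, ‖Z i ω‖ ^ 2 ∂P else 0 := by
    rw [Finset.sum_comm]
    have : ∀ i j, r i j ↔ r j i := fun i j => ⟨hsymm i j, hsymm j i⟩
    simp_rw [fun i j => this i j]
  calc _ ≤ _ := h2
    _ ≤ ∑ i ∈ S, ∑ j ∈ S, (if r i j then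
          ((∫ ω, ‖Z i ω‖ ^ 2 ∂P) + ∫ ω, ‖Z j ω‖ ^ 2 ∂P) / 2 else 0) :=
        Finset.sum_le_sum fun i hi => Finset.sum_le_sum fun j hj => h3 i hi j hj
    _ = ((∑ i ∈ S, ∑ j ∈ S, if r i j then ∫ ω, ‖Z i ω‖ ^ 2 ∂P else 0) +
          ∑ i ∈ S, ∑ j ∈ S, if r i j then ∫ ω, ‖Z j ω‖ ^ 2 ∂P else 0) / 2 := by
        rw [← Finset.sum_add_distrib, Finset.sum_div]
        refine Finset.sum_congr rfl fun i _ => ?_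
        rw [← Finset.sum_add_distrib, Finset.sum_div]
        refine Finset.sum_congr rfl fun j _ => ?_
        split_ifs <;> simp
    _ = ∑ i ∈ S, ∑ j ∈ S, if r i j then ∫ ω, ‖Z i ω‖ ^ 2 ∂P else 0 := by rw [h5]; ring
    _ ≤ ∑ i ∈ S, m * ∫ ω, ‖Z i ω‖ ^ 2 ∂P := Finset.sum_le_sum h4
    _ = _ := by rw [Finset.mul_sum]

/-- Resampling the `0`-th coordinate does not change the law. -/
lemma measurePreserving_update_zero :
    MeasurePreserving (fun p : ℂ × (ℕ → ℂ) => Function.update p.2 0 p.1)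
      (stdComplexGaussian.prod gaussianSequence) gaussianSequence := by
  have hm : Measurable fun p : ℂ × (ℕ → ℂ) => Function.update p.2 0 p.1 := by
    refine measurable_pi_lambda _ fun n => ?_
    by_cases hn : n = 0
    · subst hn; simpa using measurable_fst
    · simp only [Function.update_of_ne hn]; fun_prop
  refine ⟨hm, Measure.eq_infinitePi _ fun s t ht => ?_⟩
  have hs : (fun p : ℂ × (ℕ → ℂ) => Function.update p.2 0 p.1) ⁻¹' (Set.pi s t) =
      (if 0 ∈ s then t 0 else Set.univ) ×ˢ Set.pi (s.erase 0) t := by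
    ext p
    simp only [Set.mem_preimage, Set.mem_pi, Finset.mem_coe, Set.mem_prod, Finset.mem_erase]
    constructor
    · refine fun h => ⟨?_, fun i hi => ?_⟩
      · split_ifs with h0
        · simpa using h 0 h0
        · trivial
      · simpa [hi.1] using h i hi.2
    · rintro ⟨h0, h⟩ i hi
      by_cases hi0 : i = 0
      · subst hi0; simpa [hi] using h0
      · simpa [hi0] using h i ⟨hi0, hi⟩
  rw [Measure.map_apply hm (MeasurableSet.pi s.countable_toSet fun i _ => ht i), hs,
    Measure.prod_prod, gaussianSequence, Measure.infinitePi_pi _ (fun i _ => ht i)]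
  split_ifs with h0
  · rw [Finset.mul_prod_erase s (fun i => stdComplexGaussian (t i)) h0]
  · rw [measure_univ, one_mul, Finset.erase_eq_of_notMem h0]

/-- All moments of `X` are finite. -/
def HasMoments (X : (ℕ → ℂ) → ℂ) : Prop := ∀ p : ℝ≥0, MemLp X p gaussianSequence

lemma hasMoments_eval (n : ℕ) : HasMoments fun γ => γ n :=
  fun p => memLp_eval_gaussianSequence p n

lemma HasMoments.mul {X Y : (ℕ → ℂ) → ℂ} (hX : HasMoments X) (hY : HasMoments Y) :
    HasMoments fun γ => X γ * Y γ := fun p => by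
  have : ENNReal.HolderTriple ((2 * p : ℝ≥0) : ℝ≥0∞) ((2 * p : ℝ≥0) : ℝ≥0∞) p := by
    constructor
    push_cast
    rw [ENNReal.mul_inv (Or.inl two_ne_zero) (Or.inl ENNReal.ofNat_ne_top), ← two_mul, ← mul_assoc,
      ENNReal.mul_inv_cancel two_ne_zero ENNReal.ofNat_ne_top, one_mul]
  exact (hY (2 * p)).mul (hX (2 * p))

lemma HasMoments.conj {X : (ℕ → ℂ) → ℂ} (hX : HasMoments X) : HasMoments fun γ => conj (X γ) :=
  fun p => (hX p).star

lemma HasMoments.const_mul {X : (ℕ → ℂ) → ℂ} (hX : HasMoments X) (c : ℂ) :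
    HasMoments fun γ => c * X γ := fun p => (hX p).const_mul c

lemma HasMoments.memLp_two {X : (ℕ → ℂ) → ℂ} (hX : HasMoments X) : MemLp X 2 gaussianSequence :=
  hX 2

lemma HasMoments.integrable {X : (ℕ → ℂ) → ℂ} (hX : HasMoments X) :
    Integrable X gaussianSequence := memLp_one_iff_integrable.1 (hX 1)

/-- The absolute moment of order `p` of a standard complex Gaussian variable. -/
def absMoment (p : ℕ) : ℝ := ∫ z, ‖z‖ ^ p ∂stdComplexGaussian

lemma absMoment_nonneg (p : ℕ) : 0 ≤ absMoment p := integral_nonneg fun _ => by positivity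

lemma integral_norm_pow_eval (p n : ℕ) :
    ∫ γ, ‖γ n‖ ^ p ∂gaussianSequence = absMoment p := by
  rw [absMoment, ← (measurePreserving_eval_gaussianSequence n).map_eq,
    integral_map (measurable_pi_apply n).aemeasurable (by fun_prop)]

lemma integrable_norm_pow_eval (p n : ℕ) :
    Integrable (fun γ : ℕ → ℂ => ‖γ n‖ ^ p) gaussianSequence := by
  rcases eq_or_ne p 0 with rfl | hp
  · simp
  · exact (hasMoments_eval n p).integrable_norm_pow hp

lemma absMoment_two_pos : 0 < absMoment 2 := by
  refine lt_of_le_of_ne (absMoment_nonneg 2) fun h => ?_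
  have hi : Integrable (fun z : ℂ => ‖z‖ ^ 2) stdComplexGaussian :=
    (memLp_id_stdComplexGaussian 2).integrable_norm_pow two_ne_zero
  have h0 := (integral_eq_zero_iff_of_nonneg (fun z : ℂ => by positivity) hi).1 h.symm
  have h1 : ∀ᵐ p ∂(gaussianReal 0 (1 / 2)).prod (gaussianReal 0 (1 / 2)),
      (p.1 : ℂ) + p.2 * Complex.I = 0 := by
    refine ae_of_ae_map (f := fun p : ℝ × ℝ => (p.1 : ℂ) + p.2 * Complex.I)
      (p := fun z => z = 0) (by fun_prop) ?_
    filter_upwards [h0] with z hz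
    simpa using hz
  have h2 : ∀ᵐ x ∂gaussianReal 0 (1 / 2), x = 0 := by
    filter_upwards [Measure.ae_ae_of_ae_prod h1] with x hx
    obtain ⟨y, hy⟩ := hx.exists
    simpa using congrArg Complex.re hy
  have : NullSingletonClass (gaussianReal 0 (1 / 2)) :=
    nullSingletonClass_gaussianReal (by norm_num)
  have h3 : ∀ᵐ x ∂gaussianReal 0 (1 / 2), x ≠ 0 := by
    rw [ae_iff]
    simpa using measure_singleton (μ := gaussianReal 0 (1 / 2)) (0 : ℝ)
  obtain ⟨x, hx, hx'⟩ := (h2.and h3).exists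
  exact hx' hx

lemma iIndepFun_eval : iIndepFun (fun (n : ℕ) (γ : ℕ → ℂ) => γ n) gaussianSequence :=
  iIndepFun_infinitePi (P := fun _ => stdComplexGaussian) (X := fun _ z => z) fun _ => measurable_id

/-- The Gaussian sequence is almost surely not square summable against `1 / (n + 1)`. -/
lemma ae_not_summable_norm_sq_div :
    ∀ᵐ γ ∂gaussianSequence, ¬ Summable fun n : ℕ => ‖γ n‖ ^ 2 / ((n : ℝ) + 1) := by
  have h := strong_law_ae_real (μ := gaussianSequence) (fun n γ => ‖γ n‖ ^ 2)
    (integrable_norm_pow_eval 2 0)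
    (fun i j hij => (iIndepFun_eval.indepFun hij).comp (φ := fun z : ℂ => ‖z‖ ^ 2)
      (ψ := fun z : ℂ => ‖z‖ ^ 2) (by fun_prop) (by fun_prop))
    (fun i => IdentDistrib.comp (u := fun z : ℂ => ‖z‖ ^ 2)
      ⟨(measurable_pi_apply i).aemeasurable, (measurable_pi_apply 0).aemeasurable, by
        rw [(measurePreserving_eval_gaussianSequence i).map_eq,
          (measurePreserving_eval_gaussianSequence 0).map_eq]⟩ (by fun_prop))
  filter_upwards [h] with γ hγ hs
  rw [integral_norm_pow_eval] at hγ
  set S : ℕ → ℝ := fun n => ∑ i ∈ Finset.range n, ‖γ i‖ ^ 2 with hS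
  have hdouble : Filter.Tendsto (fun n : ℕ => 2 * n) Filter.atTop Filter.atTop :=
    Filter.tendsto_id.const_mul_atTop' two_pos
  -- The block `[n, 2n)` of a convergent series would tend to 0, but it dominates `(S (2n) - S n) /
  -- (2n)`, which tends to half the second moment by the strong law.
  have h1 : Filter.Tendsto (fun n : ℕ => S (2 * n) / (2 * n : ℕ) - S n / n / 2) Filter.atTop
      (nhds (absMoment 2 - absMoment 2 / 2)) :=
    (hγ.comp hdouble).sub (hγ.div_const 2)
  have h2 : Filter.Tendsto (fun n : ℕ =>
      (∑ i ∈ Finset.range (2 * n), ‖γ i‖ ^ 2 / ((i : ℝ) + 1)) -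
        ∑ i ∈ Finset.range n, ‖γ i‖ ^ 2 / ((i : ℝ) + 1)) Filter.atTop (nhds 0) := by
    simpa using (hs.tendsto_sum_tsum_nat.comp hdouble).sub hs.tendsto_sum_tsum_nat
  have h3 := le_of_tendsto_of_tendsto' h1 h2 fun n => by
    have hn : n ≤ 2 * n := by omega
    rw [← Finset.sum_Ico_eq_sub _ hn]
    have : S (2 * n) / (2 * n : ℕ) - S n / n / 2 =
        ∑ i ∈ Finset.Ico n (2 * n), ‖γ i‖ ^ 2 / (2 * n : ℝ) := by
      rw [← Finset.sum_div, Finset.sum_Ico_eq_sub _ hn]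
      push_cast
      ring
    rw [this]
    refine Finset.sum_le_sum fun i hi => ?_
    have : ((i : ℝ) + 1) ≤ 2 * n := by exact_mod_cast (Finset.mem_Ico.1 hi).2
    gcongr
  linarith [absMoment_two_pos]

/-- The arithmetic-geometric inequality replaces independence, so coinciding indices need no
separate case. -/
lemma integral_norm_sq_mul_le (k l : ℕ) :
    ∫ γ : ℕ → ℂ, ‖γ k‖ ^ 2 * ‖γ l‖ ^ 2 ∂gaussianSequence ≤ absMoment 4 := by
  calc ∫ γ : ℕ → ℂ, ‖γ k‖ ^ 2 * ‖γ l‖ ^ 2 ∂gaussianSequence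
      ≤ ∫ γ : ℕ → ℂ, (‖γ k‖ ^ 4 + ‖γ l‖ ^ 4) / 2 ∂gaussianSequence := by
        refine integral_mono_of_nonneg (ae_of_all _ fun γ => by positivity)
          (((integrable_norm_pow_eval 4 k).add (integrable_norm_pow_eval 4 l)).div_const 2)
          (ae_of_all _ fun γ => ?_)
        simp only
        nlinarith [sq_nonneg (‖γ k‖ ^ 2 - ‖γ l‖ ^ 2)]
    _ = absMoment 4 := by
        rw [integral_div, integral_add (integrable_norm_pow_eval 4 k)
          (integrable_norm_pow_eval 4 l), integral_norm_pow_eval, integral_norm_pow_eval]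
        ring

lemma integral_norm_sq_mul_mul_le (k l m : ℕ) :
    ∫ γ : ℕ → ℂ, ‖γ k‖ ^ 2 * ‖γ l‖ ^ 2 * ‖γ m‖ ^ 2 ∂gaussianSequence ≤ absMoment 6 := by
  have h6 := fun i => integrable_norm_pow_eval 6 i
  calc ∫ γ : ℕ → ℂ, ‖γ k‖ ^ 2 * ‖γ l‖ ^ 2 * ‖γ m‖ ^ 2 ∂gaussianSequence
      ≤ ∫ γ : ℕ → ℂ, (‖γ k‖ ^ 6 + ‖γ l‖ ^ 6 + ‖γ m‖ ^ 6) / 3 ∂gaussianSequence := by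
        refine integral_mono_of_nonneg (ae_of_all _ fun γ => by positivity)
          ((((h6 k).add (h6 l)).add (h6 m)).div_const 3) (ae_of_all _ fun γ => ?_)
        have key : ∀ x y z : ℝ, 0 ≤ x → 0 ≤ y → 0 ≤ z →
            x * y * z ≤ (x ^ 3 + y ^ 3 + z ^ 3) / 3 := fun x y z hx hy hz => by
          nlinarith [mul_nonneg (add_nonneg (add_nonneg hx hy) hz) (add_nonneg (add_nonneg
            (sq_nonneg (x - y)) (sq_nonneg (y - z))) (sq_nonneg (x - z)))]
        simpa only [← pow_mul] using key _ _ _ (sq_nonneg ‖γ k‖) (sq_nonneg ‖γ l‖) (sq_nonneg ‖γ m‖)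
    _ = absMoment 6 := by
        have h1 := integral_add ((h6 k).add (h6 l)) (h6 m)
        have h2 := integral_add (h6 k) (h6 l)
        simp only [Pi.add_apply] at h1 h2
        rw [integral_div, h1, h2]
        simp only [integral_norm_pow_eval]
        ring

/-- The fourth moment of a linear combination of independent Gaussian variables is controlled by
the square of the sum of the squares of its coefficients. -/
lemma integral_norm_sum_pow_four_le (S : Finset ℕ) (b : ℕ → ℂ) :
    ∫ γ : ℕ → ℂ, ‖∑ k ∈ S, b k * γ k‖ ^ 4 ∂gaussianSequence ≤
      2 * absMoment 4 * (∑ k ∈ S, ‖b k‖ ^ 2) ^ 2 := by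
  set Z : ℕ × ℕ → (ℕ → ℂ) → ℂ := fun p γ => (b p.1 * b p.2) * (γ p.1 * γ p.2) with hZdef
  have hm : ∀ p, HasMoments (Z p) := fun p =>
    ((hasMoments_eval p.1).mul (hasMoments_eval p.2)).const_mul _
  have hc : ∀ p, HasCharge (Z p) _ := fun p =>
    ((hasCharge_eval p.1).mul (hasCharge_eval p.2)).const_mul _
  have h := integral_norm_sq_sum_le (P := gaussianSequence) (S ×ˢ S) Z
    (fun p _ => (hm p).memLp_two) (fun p q => q = p ∨ q = p.swap)
    (by rintro p q (rfl | rfl) <;> simp) ?_ 2 ?_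
  · calc ∫ γ : ℕ → ℂ, ‖∑ k ∈ S, b k * γ k‖ ^ 4 ∂gaussianSequence
        = ∫ γ : ℕ → ℂ, ‖∑ p ∈ S ×ˢ S, Z p γ‖ ^ 2 ∂gaussianSequence := by
          congr 1; ext γ
          rw [show (4 : ℕ) = 2 * 2 from rfl, pow_mul, ← norm_pow, sq (∑ k ∈ S, b k * γ k),
            Finset.sum_mul_sum, ← Finset.sum_product']
          congr 2
          exact Finset.sum_congr rfl fun p _ => by simp only [hZdef]; ring
      _ ≤ _ := h
      _ ≤ (2 : ℕ) * ∑ p ∈ S ×ˢ S, ‖b p.1‖ ^ 2 * ‖b p.2‖ ^ 2 * absMoment 4 := by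
          gcongr with p hp
          simp only [hZdef, norm_mul, mul_pow]
          rw [integral_const_mul]
          gcongr
          exact integral_norm_sq_mul_le _ _
      _ = _ := by
          rw [← Finset.sum_mul, Finset.sum_product, sq (∑ k ∈ S, ‖b k‖ ^ 2), Finset.sum_mul_sum]
          push_cast; ring
  · intro p _ q _ hpq
    -- The charges of `γ_i γ_j` lie in `{0, 1, 2}` and determine the unordered pair, even modulo 4;
    -- only a pair and its swap can be correlated.
    have hex : ∃ k : ℕ, ¬ (4 : ℤ) ∣ ((if p.1 = k then 1 else 0) + (if p.2 = k then 1 else 0)) +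
        -((if q.1 = k then 1 else 0) + (if q.2 = k then 1 else 0)) := by
      by_contra! hall
      obtain ⟨p1, p2⟩ := p
      obtain ⟨q1, q2⟩ := q
      simp only [Prod.swap_prod_mk, Prod.mk.injEq, not_or, not_and] at hpq
      have h1 := hall p1
      have h2 := hall p2
      simp only at h1 h2
      grind
    obtain ⟨k, hk⟩ := hex
    exact ((hc p).mul (hc q).conj).integral_eq_zero
      ((hm p).mul (hm q).conj).integrable.aestronglyMeasurable hk
  · intro p _
    refine (Finset.card_le_card (t := {p, p.swap}) fun q hq => ?_).trans Finset.card_le_two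
    simpa using (Finset.mem_filter.1 hq).2

lemma ae_tsum_ne_top {Ω ι : Type*} [Countable ι] [MeasurableSpace Ω] {P : Measure Ω}
    {X : ι → Ω → ℝ≥0∞} (hX : ∀ i, AEMeasurable (X i) P) {w : ι → ℝ} (hw0 : ∀ i, 0 ≤ w i)
    (hw : Summable w) (h : ∀ i, ∫⁻ ω, X i ω ∂P ≤ ENNReal.ofReal (w i)) :
    ∀ᵐ ω ∂P, ∑' i, X i ω ≠ ∞ := by
  have h1 : ∫⁻ ω, ∑' i, X i ω ∂P ≠ ∞ := by
    rw [lintegral_tsum hX]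
    refine ne_top_of_le_ne_top ?_ (ENNReal.tsum_le_tsum h)
    rw [← ENNReal.ofReal_tsum_of_nonneg hw0 hw]
    exact ENNReal.ofReal_ne_top
  filter_upwards [ae_lt_top' (AEMeasurable.tsum hX) h1] with ω hω using hω.ne

/-! ### The random series in `L²` -/

/-- The `n`-th Fourier coefficient of the initial datum. -/
def coeff (α : ℝ) (γ : ℕ → ℂ) (n : ℕ) : ℂ := γ n / (Real.sqrt (1 + (n : ℝ) ^ (2 * α)) : ℂ)

/-- The variance `1 / (1 + n ^ (2α))` of the `n`-th Fourier coefficient of the initial datum. -/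
def variance (α : ℝ) (n : ℕ) : ℝ := 1 / (1 + (n : ℝ) ^ (2 * α))

lemma variance_nonneg (α : ℝ) (n : ℕ) : 0 ≤ variance α n := by unfold variance; positivity

lemma coeff_eq (α : ℝ) (γ : ℕ → ℂ) (n : ℕ) :
    coeff α γ n = ((Real.sqrt (variance α n) : ℝ) : ℂ) * γ n := by
  rw [coeff, variance, Real.sqrt_div zero_le_one, Real.sqrt_one]
  push_cast
  ring

lemma norm_coeff_sq (α : ℝ) (γ : ℕ → ℂ) (n : ℕ) :
    ‖coeff α γ n‖ ^ 2 = variance α n * ‖γ n‖ ^ 2 := by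
  rw [coeff_eq, norm_mul, mul_pow, Complex.norm_real, Real.norm_eq_abs, sq_abs,
    Real.sq_sqrt (variance_nonneg α n)]

lemma summable_variance {α : ℝ} (hα : 1 / 2 < α) : Summable (variance α) := by
  refine Summable.of_norm_bounded_eventually_nat (g := fun n : ℕ => 1 / (n : ℝ) ^ (2 * α))
    (Real.summable_one_div_nat_rpow.2 (by linarith)) ?_
  filter_upwards [Filter.eventually_gt_atTop 0] with n hn
  rw [Real.norm_of_nonneg (variance_nonneg α n), variance]
  have : (0 : ℝ) < (n : ℝ) ^ (2 * α) := Real.rpow_pos_of_pos (by exact_mod_cast hn) _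
  gcongr
  linarith

lemma ae_summable_norm_coeff_sq {α : ℝ} (hα : 1 / 2 < α) :
    ∀ᵐ γ ∂gaussianSequence, Summable fun n => ‖coeff α γ n‖ ^ 2 := by
  have h := ae_tsum_ne_top (P := gaussianSequence)
    (X := fun n γ => ENNReal.ofReal (variance α n * ‖γ n‖ ^ 2))
    (w := fun n => variance α n * absMoment 2) (fun n => by
      exact (((measurable_pi_apply n).norm.pow_const 2).const_mul _).ennreal_ofReal.aemeasurable)
    (fun n => mul_nonneg (variance_nonneg α n) (absMoment_nonneg 2))
    ((summable_variance hα).mul_right _) (fun n => by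
      rw [← ofReal_integral_eq_lintegral_ofReal ((integrable_norm_pow_eval 2 n).const_mul _)
        (ae_of_all _ fun γ => mul_nonneg (variance_nonneg α n) (by positivity)),
        integral_const_mul, integral_norm_pow_eval])
  filter_upwards [h] with γ hγ
  have h1 := ENNReal.summable_toReal hγ
  refine h1.congr fun n => ?_
  rw [ENNReal.toReal_ofReal (mul_nonneg (variance_nonneg α n) (by positivity)), norm_coeff_sq]

lemma summable_randomTerm {α : ℝ} {γ : ℕ → ℂ} (h : Summable fun n => ‖coeff α γ n‖ ^ 2) :
    Summable (randomTerm α γ) := by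
  have horth : Orthonormal ℂ fun n : ℕ =>
      (fourierLp 2 (n : ℤ) : Lp ℂ 2 (AddCircle.haarAddCircle : Measure Torus)) :=
    orthonormal_fourier.comp _ Nat.cast_injective
  exact (horth.orthogonalFamily.summable_iff_norm_sq_summable (coeff α γ)).2 h

lemma fourierCoeff_Lp_two (f : Lp ℂ 2 (AddCircle.haarAddCircle : Measure Torus)) (n : ℤ) :
    fourierCoeff f n = inner ℂ (fourierLp 2 n) f := by
  rw [← fourierBasis_repr, HilbertBasis.repr_apply_apply, coe_fourierBasis]

/-- The extension by zero of a sequence of Fourier coefficients to the negative frequencies. -/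
def extendZero (a : ℕ → ℂ) (n : ℤ) : ℂ := if 0 ≤ n then a n.toNat else 0

lemma fourierCoeff_initialDatum {α : ℝ} {γ : ℕ → ℂ} (h : Summable (randomTerm α γ)) (n : ℤ) :
    fourierCoeff (initialDatum α γ) n = extendZero (coeff α γ) n := by
  rw [fourierCoeff_Lp_two, initialDatum]
  have h1 :=
    (innerSL ℂ (fourierLp 2 n : Lp ℂ 2 (AddCircle.haarAddCircle : Measure Torus))).map_tsum h
  simp only [innerSL_apply_apply] at h1
  rw [h1]
  have h2 : ∀ k : ℕ, inner ℂ (fourierLp 2 n : Lp ℂ 2 (AddCircle.haarAddCircle : Measure Torus))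
      (randomTerm α γ k) = if (k : ℤ) = n then coeff α γ k else 0 := fun k => by
    rw [randomTerm, inner_smul_right, orthonormal_iff_ite.1 orthonormal_fourier]
    simp only [eq_comm (a := n), coeff, mul_ite, mul_one, mul_zero]
  simp_rw [h2, extendZero]
  split_ifs with hn
  · rw [tsum_eq_single n.toNat fun k hk => if_neg fun h => hk (by omega), if_pos (by omega)]
  · rw [tsum_congr fun k => if_neg (by omega), tsum_zero]

/-! ### Convergence of the partial sums in `L⁴` -/

/-- The trigonometric polynomial with coefficients `a` on a finite set `S` of frequencies. -/
def trigPoly (S : Finset ℕ) (a : ℕ → ℂ) : C(Torus, ℂ) := ∑ k ∈ S, a k • fourier (k : ℤ)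

lemma trigPoly_apply (S : Finset ℕ) (a : ℕ → ℂ) (x : Torus) :
    trigPoly S a x = ∑ k ∈ S, a k * fourier (k : ℤ) x := by
  simp [trigPoly, ContinuousMap.sum_apply]

/-- A trigonometric polynomial as an element of `Lᵖ`. -/
def trigPolyLp (p : ℝ≥0∞) [Fact (1 ≤ p)] (S : Finset ℕ) (a : ℕ → ℂ) :
    Lp ℂ p (AddCircle.haarAddCircle : Measure Torus) :=
  ContinuousMap.toLp (E := ℂ) p AddCircle.haarAddCircle ℂ (trigPoly S a)

lemma coeFn_trigPolyLp (p : ℝ≥0∞) [Fact (1 ≤ p)] (S : Finset ℕ) (a : ℕ → ℂ) :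
    trigPolyLp p S a =ᵐ[AddCircle.haarAddCircle] trigPoly S a :=
  ContinuousMap.coeFn_toLp _ _

lemma trigPolyLp_eq_sum (p : ℝ≥0∞) [Fact (1 ≤ p)] (S : Finset ℕ) (a : ℕ → ℂ) :
    trigPolyLp p S a = ∑ k ∈ S, a k • fourierLp p (k : ℤ) := by
  simp only [trigPolyLp, trigPoly, map_sum, map_smul, fourierLp]

instance : Fact ((1 : ℝ≥0∞) ≤ 4) := ⟨by norm_num⟩

instance : ENNReal.HolderTriple 4 4 2 := ⟨by
  rw [← two_mul, show (4 : ℝ≥0∞) = 2 * 2 by norm_num,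
    ENNReal.mul_inv (Or.inl two_ne_zero) (Or.inl ENNReal.ofNat_ne_top), ← mul_assoc,
    ENNReal.mul_inv_cancel two_ne_zero ENNReal.ofNat_ne_top, one_mul]⟩

lemma enorm_trigPolyLp_pow_four (S : Finset ℕ) (a : ℕ → ℂ) :
    ‖trigPolyLp 4 S a‖ₑ ^ 4 =
      ∫⁻ x, ‖trigPoly S a x‖ₑ ^ 4 ∂(AddCircle.haarAddCircle : Measure Torus) := by
  have h := eLpNorm_nnreal_pow_eq_lintegral (p := 4) (f := trigPolyLp 4 S a)
    (μ := (AddCircle.haarAddCircle : Measure Torus)) (by norm_num)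
  rw [Lp.enorm_def]
  simp only [ENNReal.coe_ofNat, NNReal.coe_ofNat, ENNReal.rpow_ofNat] at h
  rw [h]
  refine lintegral_congr_ae ?_
  filter_upwards [coeFn_trigPolyLp 4 S a] with x hx
  rw [hx]

lemma fourier_norm_apply (n : ℤ) (x : Torus) : ‖fourier n x‖ = 1 := by
  rw [fourier_apply, Circle.norm_coe]

lemma hasMoments_sum {ι : Type*} (S : Finset ι) {X : ι → (ℕ → ℂ) → ℂ} (h : ∀ i, HasMoments (X i)) :
    HasMoments fun γ => ∑ i ∈ S, X i γ := fun p => memLp_finsetSum S fun i _ => h i p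

lemma measurable_trigPoly_coeff (α : ℝ) (S : Finset ℕ) :
    Measurable fun p : (ℕ → ℂ) × Torus => trigPoly S (coeff α p.1) p.2 := by
  simp only [trigPoly_apply, coeff_eq]
  refine Finset.measurable_sum _ fun k _ => Measurable.mul (Measurable.const_mul
    ((measurable_pi_apply k).comp measurable_fst) _) ((fourier (k : ℤ)).continuous.measurable.comp
    measurable_snd)

/-- The expected fourth power of the `L⁴` norm of a partial sum of the random series. -/
lemma lintegral_enorm_trigPolyLp_le (α : ℝ) (S : Finset ℕ) :
    ∫⁻ γ, ‖trigPolyLp 4 S (coeff α γ)‖ₑ ^ 4 ∂gaussianSequence ≤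
      ENNReal.ofReal (2 * absMoment 4 * (∑ k ∈ S, variance α k) ^ 2) := by
  simp_rw [enorm_trigPolyLp_pow_four]
  rw [lintegral_lintegral_swap ((measurable_trigPoly_coeff α S).enorm.pow_const 4).aemeasurable]
  have hx : ∀ x : Torus, ∫⁻ γ, ‖trigPoly S (coeff α γ) x‖ₑ ^ 4 ∂gaussianSequence ≤
      ENNReal.ofReal (2 * absMoment 4 * (∑ k ∈ S, variance α k) ^ 2) := by
    intro x
    set b : ℕ → ℂ := fun k => ((Real.sqrt (variance α k) : ℝ) : ℂ) * fourier (k : ℤ) x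
    have h1 : ∀ γ, trigPoly S (coeff α γ) x = ∑ k ∈ S, b k * γ k := fun γ => by
      rw [trigPoly_apply]
      exact Finset.sum_congr rfl fun k _ => by rw [coeff_eq]; ring
    have hm : HasMoments fun γ => ∑ k ∈ S, b k * γ k :=
      hasMoments_sum S fun k => (hasMoments_eval k).const_mul _
    have h2 := integral_norm_sum_pow_four_le S b
    have h3 : ∀ k, ‖b k‖ ^ 2 = variance α k := fun k => by
      rw [norm_mul, fourier_norm_apply, mul_one, Complex.norm_real, Real.norm_eq_abs, sq_abs,
        Real.sq_sqrt (variance_nonneg α k)]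
    simp_rw [h3] at h2
    refine le_trans (le_of_eq ?_) (ENNReal.ofReal_le_ofReal h2)
    rw [ofReal_integral_eq_lintegral_ofReal ((hm 4).integrable_norm_pow four_ne_zero)
      (ae_of_all _ fun γ => by positivity)]
    refine lintegral_congr fun γ => ?_
    rw [h1, ENNReal.ofReal_pow (norm_nonneg _), ofReal_norm]
  refine (lintegral_mono hx).trans ?_
  simp

lemma measurable_enorm_trigPolyLp (α : ℝ) (S : Finset ℕ) :
    Measurable fun γ => ‖trigPolyLp 4 S (coeff α γ)‖ₑ ^ 4 := by
  simp_rw [enorm_trigPolyLp_pow_four]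
  exact ((measurable_trigPoly_coeff α S).enorm.pow_const 4).lintegral_prod_right'

lemma exists_strictMono_sum_Ico_le {w : ℕ → ℝ} (hw0 : ∀ n, 0 ≤ w n) (hw : Summable w)
    {δ : ℕ → ℝ} (hδ : ∀ j, 0 < δ j) :
    ∃ φ : ℕ → ℕ, StrictMono φ ∧ ∀ j, ∑ k ∈ Finset.Ico (φ j) (φ (j + 1)), w k ≤ δ j := by
  have h : ∀ j, ∀ᶠ n in Filter.atTop, (∑' k, w k) - δ j < ∑ k ∈ Finset.range n, w k := fun j =>
    hw.hasSum.tendsto_sum_nat.eventually_const_lt (by linarith [hδ j])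
  obtain ⟨φ, hφ, hφ'⟩ := Filter.extraction_forall_of_eventually h
  refine ⟨φ, hφ, fun j => ?_⟩
  rw [Finset.sum_Ico_eq_sub _ (hφ.monotone j.le_succ)]
  have := hw.sum_le_tsum (Finset.range (φ (j + 1))) fun k _ => hw0 k
  linarith [hφ' j]

/-- Along a subsequence, the partial sums of the random series converge in `L⁴`. -/
lemma exists_tendsto_trigPolyLp {α : ℝ} (hα : 1 / 2 < α) :
    ∃ φ : ℕ → ℕ, StrictMono φ ∧ ∀ᵐ γ ∂gaussianSequence,
      ∃ f, Filter.Tendsto (fun j => trigPolyLp 4 (Finset.range (φ j)) (coeff α γ)) Filter.atTop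
        (nhds f) := by
  -- Blocks of variance at most `16⁻ʲ` have `E‖D_j‖⁴` of order `256⁻ʲ`, so the weight `8ʲ` still
  -- leaves the summable `32⁻ʲ`.
  obtain ⟨φ, hφ, hφ'⟩ := exists_strictMono_sum_Ico_le (variance_nonneg α) (summable_variance hα)
    (δ := fun j => (1 / 16 : ℝ) ^ j) (fun j => by positivity)
  refine ⟨φ, hφ, ?_⟩
  set D : ℕ → (ℕ → ℂ) → Lp ℂ 4 (AddCircle.haarAddCircle : Measure Torus) := fun j γ =>
    trigPolyLp 4 (Finset.Ico (φ j) (φ (j + 1))) (coeff α γ) with hD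
  have hsum := ae_tsum_ne_top (P := gaussianSequence)
    (X := fun j γ => ENNReal.ofReal (8 ^ j) * ‖D j γ‖ₑ ^ 4)
    (w := fun j => 2 * absMoment 4 * (1 / 32 : ℝ) ^ j)
    (fun j => ((measurable_enorm_trigPolyLp α _).const_mul _).aemeasurable)
    (fun j => mul_nonneg (mul_nonneg zero_le_two (absMoment_nonneg 4)) (by positivity))
    ((summable_geometric_of_lt_one (by norm_num) (by norm_num)).mul_left _) (fun j => by
      rw [lintegral_const_mul _ (measurable_enorm_trigPolyLp α _)]
      refine (mul_le_mul_right (lintegral_enorm_trigPolyLp_le α _) _).trans ?_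
      rw [← ENNReal.ofReal_mul (by positivity)]
      refine ENNReal.ofReal_le_ofReal ?_
      have h0 : 0 ≤ ∑ k ∈ Finset.Ico (φ j) (φ (j + 1)), variance α k :=
        Finset.sum_nonneg fun k _ => variance_nonneg α k
      have h1 := pow_le_pow_left₀ h0 (hφ' j) 2
      calc (8 : ℝ) ^ j * (2 * absMoment 4 *
            (∑ k ∈ Finset.Ico (φ j) (φ (j + 1)), variance α k) ^ 2)
          ≤ (8 : ℝ) ^ j * (2 * absMoment 4 * ((1 / 16 : ℝ) ^ j) ^ 2) := by
            have := absMoment_nonneg 4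
            gcongr
        _ = 2 * absMoment 4 * (8 * (1 / 16) ^ 2) ^ j := by
            rw [mul_pow, ← pow_mul, ← pow_mul, mul_comm j 2]; ring
        _ = _ := by norm_num)
  filter_upwards [hsum] with γ hγ
  refine cauchySeq_tendsto_of_complete (cauchySeq_of_summable_dist ?_)
  have h1 : ∀ j, dist (trigPolyLp 4 (Finset.range (φ j)) (coeff α γ))
      (trigPolyLp 4 (Finset.range (φ (j + 1))) (coeff α γ)) = ‖D j γ‖ := fun j => by
    rw [dist_comm, dist_eq_norm, trigPolyLp_eq_sum, trigPolyLp_eq_sum,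
      ← Finset.sum_Ico_eq_sub _ (hφ.monotone j.le_succ), hD]
    simp only [trigPolyLp_eq_sum]
  simp_rw [h1]
  have h2 := ENNReal.summable_toReal hγ
  refine Summable.of_nonneg_of_le (fun j => norm_nonneg _) (fun j => ?_)
    ((summable_geometric_of_lt_one (r := 1 / 2) (by norm_num) (by norm_num)).add h2)
  rw [ENNReal.toReal_mul, ENNReal.toReal_pow, toReal_enorm, ENNReal.toReal_ofReal (by positivity)]
  -- Either `‖D_j‖ ≤ 2⁻ʲ`, or `8ʲ ‖D_j‖³ ≥ 1` and hence `‖D_j‖ ≤ 8ʲ ‖D_j‖⁴`.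
  rcases le_or_gt ‖D j γ‖ ((1 / 2) ^ j) with h | h
  · have : 0 ≤ (8 : ℝ) ^ j * ‖D j γ‖ ^ 4 := by positivity
    linarith
  · have h3 : ((1 / 2 : ℝ) ^ j) ^ 3 ≤ ‖D j γ‖ ^ 3 := by gcongr
    have h4 : (8 : ℝ) ^ j * ((1 / 2 : ℝ) ^ j) ^ 3 = 1 := by
      rw [← pow_mul, mul_comm j 3, pow_mul, ← mul_pow]; norm_num
    have h5 : 1 ≤ (8 : ℝ) ^ j * ‖D j γ‖ ^ 3 := by
      rw [← h4]; gcongr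
    have h6 : (0 : ℝ) < (1 / 2) ^ j := by positivity
    nlinarith [norm_nonneg (D j γ)]

/-- The `L⁴` and `L²` limits are both limits in measure of the same polynomials. -/
lemma ae_eq_initialDatum {α : ℝ} {γ : ℕ → ℂ} (h : Summable (randomTerm α γ)) {φ : ℕ → ℕ}
    (hφ : StrictMono φ) {f : Lp ℂ 4 (AddCircle.haarAddCircle : Measure Torus)}
    (hf : Filter.Tendsto (fun j => trigPolyLp 4 (Finset.range (φ j)) (coeff α γ)) Filter.atTop
      (nhds f)) : f =ᵐ[AddCircle.haarAddCircle] initialDatum α γ := by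
  have h1 : Filter.Tendsto (fun j => trigPolyLp 2 (Finset.range (φ j)) (coeff α γ)) Filter.atTop
      (nhds (initialDatum α γ)) := by
    simp_rw [trigPolyLp_eq_sum]
    exact h.hasSum.tendsto_sum_nat.comp hφ.tendsto_atTop
  exact tendstoInMeasure_ae_unique
    ((tendstoInMeasure_of_tendsto_Lp hf).congr_left fun j => coeFn_trigPolyLp 4 _ _)
    ((tendstoInMeasure_of_tendsto_Lp h1).congr_left fun j => coeFn_trigPolyLp 2 _ _)

/-! ### Fourier coefficients of the cubic term -/

/-- The `n`-th Fourier coefficient of `|f|² f` as a continuous function of `f ∈ L⁴`. -/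
def cubicCoeff (n : ℤ) (f : Lp ℂ 4 (AddCircle.haarAddCircle : Measure Torus)) : ℂ :=
  inner ℂ (fourierLp (T := 2 * Real.pi) 4 n • f : Lp ℂ 2 (AddCircle.haarAddCircle : Measure Torus))
    (f • f : Lp ℂ 2 (AddCircle.haarAddCircle : Measure Torus))

/-- Pairing `e_n f` with `f²` in `L²` involves only the product `L⁴ × L⁴ → L²`, a bounded bilinear
map by Hölder. -/
lemma continuous_cubicCoeff (n : ℤ) : Continuous (cubicCoeff n) := by

  have h1 : ∀ f g : Lp ℂ 4 (AddCircle.haarAddCircle : Measure Torus),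
      (f • g : Lp ℂ 2 (AddCircle.haarAddCircle : Measure Torus)) =
        (ContinuousLinearMap.lsmul ℂ ℂ : ℂ →L[ℂ] ℂ →L[ℂ] ℂ).holderL
          (AddCircle.haarAddCircle : Measure Torus) 4 4 2 f g := fun f g => rfl
  unfold cubicCoeff
  simp only [h1]
  fun_prop

lemma cubicCoeff_eq (n : ℤ) (f : Lp ℂ 4 (AddCircle.haarAddCircle : Measure Torus)) :
    cubicCoeff n f = fourierCoeff (tripleProduct f f f) n := by
  rw [cubicCoeff, L2.inner_def, fourierCoeff]
  refine integral_congr_ae ?_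
  filter_upwards [Lp.coeFn_lpSMul (r := 2) (fourierLp 4 n) f, Lp.coeFn_lpSMul (r := 2) f f,
    coeFn_fourierLp 4 n] with x h1 h2 h3
  rw [h1, h2]
  simp only [Pi.smul_apply', smul_eq_mul, h3, tripleProduct, RCLike.inner_apply, map_mul,
    fourier_neg]
  ring

lemma integrable_tripleProduct {f : Torus → ℂ} (hf : MemLp f 4 AddCircle.haarAddCircle) :
    Integrable (tripleProduct f f f) AddCircle.haarAddCircle := by
  have h1 : MemLp (fun x => f x * f x) 2 AddCircle.haarAddCircle := hf.mul' (p := 4) (q := 4) hf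
  have h2 : MemLp (fun x => conj (f x)) 2 AddCircle.haarAddCircle :=
    (hf.mono_exponent (by norm_num)).star
  refine (h1.integrable_mul h2).congr (ae_of_all _ fun x => ?_)
  simp only [tripleProduct, Pi.mul_apply]
  ring

/-- The `n`-th Fourier coefficient of `|p|² p`, `p` a trigonometric polynomial of degree less than
`N` with coefficients `a`. -/
def cubicSum (N : ℕ) (n : ℤ) (a : ℕ → ℂ) : ℂ :=
  ∑ p ∈ (Finset.range N ×ˢ Finset.range N ×ˢ Finset.range N).filter
    (fun p : ℕ × ℕ × ℕ => (p.1 : ℤ) - p.2.1 + p.2.2 = n), a p.1 * conj (a p.2.1) * a p.2.2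

lemma cubicCoeff_trigPolyLp (N : ℕ) (n : ℤ) (a : ℕ → ℂ) :
    cubicCoeff n (trigPolyLp 4 (Finset.range N) a) = cubicSum N n a := by
  set S := Finset.range N ×ˢ Finset.range N ×ˢ Finset.range N
  have h1 : tripleProduct (trigPolyLp 4 (Finset.range N) a) (trigPolyLp 4 (Finset.range N) a)
      (trigPolyLp 4 (Finset.range N) a) =ᵐ[AddCircle.haarAddCircle]
      ∑ p ∈ S, fun x => (a p.1 * conj (a p.2.1) * a p.2.2) *
        fourier ((p.1 : ℤ) - p.2.1 + p.2.2) x := by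
    filter_upwards [coeFn_trigPolyLp 4 (Finset.range N) a] with x hx
    simp only [tripleProduct, hx, trigPoly_apply, map_sum, S, Finset.sum_apply]
    rw [Finset.sum_mul_sum, Finset.sum_mul, Finset.sum_product]
    refine Finset.sum_congr rfl fun k _ => ?_
    rw [Finset.sum_mul, Finset.sum_product]
    refine Finset.sum_congr rfl fun l _ => ?_
    rw [Finset.mul_sum]
    refine Finset.sum_congr rfl fun m _ => ?_
    rw [fourier_add, sub_eq_add_neg, fourier_add, fourier_neg, map_mul]
    ring
  rw [cubicCoeff_eq, fourierCoeff_congr_ae h1, fourierCoeff.sum]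
  · simp_rw [Finset.sum_apply, fourierCoeff.const_mul, fourierCoeff_fourier, cubicSum,
      Finset.sum_filter]
    refine Finset.sum_congr rfl fun p _ => ?_
    by_cases h : (p.1 : ℤ) - p.2.1 + p.2.2 = n
    · simp [h]
    · rw [if_neg h, Pi.single_eq_of_ne (Ne.symm h), mul_zero]
  · intro p _
    exact (Integrable.of_bound (fourier _).continuous.aestronglyMeasurable 1
      (ae_of_all _ fun x => (fourier_norm_apply _ x).le)).const_mul _

/-- `u₀` lies in `L⁴`, and along a deterministic subsequence the Fourier coefficients of the cubic
expressions in the partial sums converge to those of `|u₀|² u₀`. -/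
lemma exists_tendsto_cubicSum {α : ℝ} (hα : 1 / 2 < α) :
    ∃ φ : ℕ → ℕ, ∀ᵐ γ ∂gaussianSequence, Summable (randomTerm α γ) ∧
      MemLp (initialDatum α γ) 4 AddCircle.haarAddCircle ∧
      ∀ n, Filter.Tendsto (fun j => cubicSum (φ j) n (coeff α γ)) Filter.atTop
        (nhds (fourierCoeff (tripleProduct (initialDatum α γ) (initialDatum α γ)
          (initialDatum α γ)) n)) := by
  obtain ⟨φ, hφ, h⟩ := exists_tendsto_trigPolyLp hα
  refine ⟨φ, ?_⟩
  filter_upwards [h, ae_summable_norm_coeff_sq hα] with γ ⟨f, hf⟩ hs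
  have hs' := summable_randomTerm hs
  have hae := ae_eq_initialDatum hs' hφ hf
  refine ⟨hs', (memLp_congr_ae hae).1 (Lp.memLp f), fun n => ?_⟩
  have h1 : tripleProduct (initialDatum α γ) (initialDatum α γ) (initialDatum α γ)
      =ᵐ[AddCircle.haarAddCircle] tripleProduct f f f := by
    filter_upwards [hae] with x hx
    simp only [tripleProduct, hx]
  rw [fourierCoeff_congr_ae h1, ← cubicCoeff_eq]
  simp_rw [← cubicCoeff_trigPolyLp]
  exact ((continuous_cubicCoeff n).tendsto f).comp hf

/-! ### Second moments of the truncated cubic coefficients -/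

lemma sum_comp_le_of_injOn {ι κ : Type*} [DecidableEq κ] {S : Finset ι} {T : Finset κ} {f : ι → κ}
    (hf : Set.InjOn f S) (hST : ∀ i ∈ S, f i ∈ T) {h : κ → ℝ} (h0 : ∀ j, 0 ≤ h j) :
    ∑ i ∈ S, h (f i) ≤ ∑ j ∈ T, h j := by
  rw [← Finset.sum_image (f := h) hf]
  exact Finset.sum_le_sum_of_subset_of_nonneg (Finset.image_subset_iff.2 hST) fun j _ _ => h0 j

lemma variance_le {α : ℝ} (hα : 0 < α) {k n : ℕ} (h : n ≤ 2 * k) :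
    variance α k ≤ 2 ^ (2 * α) * variance α n := by
  have h1 : (n : ℝ) ^ (2 * α) ≤ 2 ^ (2 * α) * (k : ℝ) ^ (2 * α) := by
    rw [← Real.mul_rpow zero_le_two (Nat.cast_nonneg k)]
    exact Real.rpow_le_rpow (Nat.cast_nonneg n) (by exact_mod_cast h) (by linarith)
  have h2 : (1 : ℝ) ≤ 2 ^ (2 * α) := Real.one_le_rpow one_le_two (by linarith)
  have h3 : (0 : ℝ) ≤ (k : ℝ) ^ (2 * α) := by positivity
  have h4 : (0 : ℝ) ≤ (n : ℝ) ^ (2 * α) := by positivity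
  rw [variance, variance, mul_one_div, div_le_div_iff₀ (by linarith) (by linarith)]
  linarith

/-- The frequencies contributing to `cubicSum N n`. -/
def cubicIndex (N : ℕ) (n : ℤ) : Finset (ℕ × ℕ × ℕ) :=
  (Finset.range N ×ˢ Finset.range N ×ˢ Finset.range N).filter
    (fun p : ℕ × ℕ × ℕ => (p.1 : ℤ) - p.2.1 + p.2.2 = n)

/-- The monomial `a_k ā_l a_m`. -/
def cubicTerm (a : ℕ → ℂ) (p : ℕ × ℕ × ℕ) : ℂ := a p.1 * conj (a p.2.1) * a p.2.2

lemma mem_cubicIndex {N : ℕ} {n : ℤ} {p : ℕ × ℕ × ℕ} :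
    p ∈ cubicIndex N n ↔ (p.1 < N ∧ p.2.1 < N ∧ p.2.2 < N) ∧ (p.1 : ℤ) - p.2.1 + p.2.2 = n := by
  simp [cubicIndex]

lemma hasMoments_coeff (α : ℝ) (n : ℕ) : HasMoments fun γ => coeff α γ n := by
  simp_rw [coeff_eq]
  exact (hasMoments_eval n).const_mul _

lemma hasCharge_coeff (α : ℝ) (n : ℕ) :
    HasCharge (fun γ => coeff α γ n) (fun k => if n = k then 1 else 0) := by
  simp_rw [coeff_eq]
  exact (hasCharge_eval n).const_mul _

lemma hasMoments_cubicTerm (α : ℝ) (p : ℕ × ℕ × ℕ) :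
    HasMoments fun γ => cubicTerm (coeff α γ) p :=
  ((hasMoments_coeff α _).mul (hasMoments_coeff α _).conj).mul (hasMoments_coeff α _)

lemma hasMoments_cubicSum (α : ℝ) (N : ℕ) (n : ℤ) :
    HasMoments fun γ => cubicSum N n (coeff α γ) :=
  hasMoments_sum (cubicIndex N n) (hasMoments_cubicTerm α)

lemma norm_cubicTerm_sq (α : ℝ) (γ : ℕ → ℂ) (p : ℕ × ℕ × ℕ) :
    ‖cubicTerm (coeff α γ) p‖ ^ 2 = variance α p.1 * variance α p.2.1 * variance α p.2.2 *
      (‖γ p.1‖ ^ 2 * ‖γ p.2.1‖ ^ 2 * ‖γ p.2.2‖ ^ 2) := by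
  simp only [cubicTerm, norm_mul, mul_pow, RCLike.norm_conj, norm_coeff_sq]
  ring

lemma integral_norm_cubicTerm_sq_le (α : ℝ) (p : ℕ × ℕ × ℕ) :
    ∫ γ, ‖cubicTerm (coeff α γ) p‖ ^ 2 ∂gaussianSequence ≤
      variance α p.1 * variance α p.2.1 * variance α p.2.2 * absMoment 6 := by
  simp_rw [norm_cubicTerm_sq]
  rw [integral_const_mul]
  have h := fun n => variance_nonneg α n
  exact mul_le_mul_of_nonneg_left (integral_norm_sq_mul_mul_le _ _ _)
    (mul_nonneg (mul_nonneg (h _) (h _)) (h _))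

/-- The resonant frequencies: those for which `ā_l` cancels `a_k` or `a_m`. -/
def resonantIndex (N : ℕ) (n : ℤ) : Finset (ℕ × ℕ × ℕ) :=
  (cubicIndex N n).filter fun p => p.2.1 = p.1 ∨ p.2.1 = p.2.2

/-- The non-resonant frequencies. -/
def nonresonantIndex (N : ℕ) (n : ℤ) : Finset (ℕ × ℕ × ℕ) :=
  (cubicIndex N n).filter fun p => ¬ (p.2.1 = p.1 ∨ p.2.1 = p.2.2)

/-- If `l = k` then `m = n`, and symmetrically, so each of the two classes is `a_n` times a partial
sum of `∑ |a_k|²`. Their overlap has a nonnegative contribution, which is dropped. -/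
lemma norm_sum_resonantIndex_le (N n : ℕ) (a : ℕ → ℂ) :
    ‖∑ p ∈ resonantIndex N n, cubicTerm a p‖ ≤ 2 * (‖a n‖ * ∑ k ∈ Finset.range N, ‖a k‖ ^ 2) := by
  refine (norm_sum_le _ _).trans ?_
  rw [resonantIndex, Finset.filter_or]
  have h0 := Finset.sum_union_inter (s₁ := (cubicIndex N n).filter fun p => p.2.1 = p.1)
    (s₂ := (cubicIndex N n).filter fun p => p.2.1 = p.2.2) (f := fun p => ‖cubicTerm a p‖)
  have hpos : 0 ≤ ∑ p ∈ (cubicIndex N n).filter (fun p => p.2.1 = p.1) ∩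
      (cubicIndex N n).filter (fun p => p.2.1 = p.2.2), ‖cubicTerm a p‖ :=
    Finset.sum_nonneg fun _ _ => norm_nonneg _
  have h1 : ∑ p ∈ (cubicIndex N n).filter (fun p => p.2.1 = p.1), ‖cubicTerm a p‖ ≤
      ∑ k ∈ Finset.range N, ‖a n‖ * ‖a k‖ ^ 2 := by
    refine le_trans (le_of_eq ?_) (sum_comp_le_of_injOn (T := Finset.range N) (f := fun p => p.1)
      (S := (cubicIndex N n).filter fun p => p.2.1 = p.1) (h := fun k => ‖a n‖ * ‖a k‖ ^ 2)
      ?_ ?_ fun k => by positivity)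
    · refine Finset.sum_congr rfl fun p hp => ?_
      obtain ⟨⟨-, hp1⟩, hp2⟩ := Finset.mem_filter.1 hp |>.imp_left mem_cubicIndex.1
      have : p.2.2 = n := by omega
      simp only [cubicTerm, norm_mul, RCLike.norm_conj, hp2, this]
      ring
    · intro p hp q hq hpq
      obtain ⟨⟨-, hp1⟩, hp2⟩ := Finset.mem_filter.1 hp |>.imp_left mem_cubicIndex.1
      obtain ⟨⟨-, hq1⟩, hq2⟩ := Finset.mem_filter.1 hq |>.imp_left mem_cubicIndex.1
      simp only at hpq
      ext <;> omega
    · intro p hp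
      obtain ⟨⟨hp0, -⟩, -⟩ := Finset.mem_filter.1 hp |>.imp_left mem_cubicIndex.1
      exact Finset.mem_range.2 hp0.1
  have h2 : ∑ p ∈ (cubicIndex N n).filter (fun p => p.2.1 = p.2.2), ‖cubicTerm a p‖ ≤
      ∑ k ∈ Finset.range N, ‖a n‖ * ‖a k‖ ^ 2 := by
    refine le_trans (le_of_eq ?_) (sum_comp_le_of_injOn (T := Finset.range N) (f := fun p => p.2.2)
      (S := (cubicIndex N n).filter fun p => p.2.1 = p.2.2) (h := fun k => ‖a n‖ * ‖a k‖ ^ 2)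
      ?_ ?_ fun k => by positivity)
    · refine Finset.sum_congr rfl fun p hp => ?_
      obtain ⟨⟨-, hp1⟩, hp2⟩ := Finset.mem_filter.1 hp |>.imp_left mem_cubicIndex.1
      have : p.1 = n := by omega
      simp only [cubicTerm, norm_mul, RCLike.norm_conj, hp2, this]
      ring
    · intro p hp q hq hpq
      obtain ⟨⟨-, hp1⟩, hp2⟩ := Finset.mem_filter.1 hp |>.imp_left mem_cubicIndex.1
      obtain ⟨⟨-, hq1⟩, hq2⟩ := Finset.mem_filter.1 hq |>.imp_left mem_cubicIndex.1
      simp only at hpq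
      ext <;> omega
    · intro p hp
      obtain ⟨⟨hp0, -⟩, -⟩ := Finset.mem_filter.1 hp |>.imp_left mem_cubicIndex.1
      exact Finset.mem_range.2 hp0.2.2
  rw [← Finset.mul_sum] at h1 h2
  linarith

/-- Resonant monomials all carry the charge of `a_n`, so orthogonality is of no help. Instead the
squared pointwise bound is itself a sum of terms `|a_n ā_k a_l|²`. -/
lemma integral_norm_sum_resonantIndex_sq_le (α : ℝ) (N n : ℕ) :
    ∫ γ, ‖∑ p ∈ resonantIndex N n, cubicTerm (coeff α γ) p‖ ^ 2 ∂gaussianSequence ≤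
      4 * absMoment 6 * (∑ k ∈ Finset.range N, variance α k) ^ 2 * variance α n := by
  have hint : ∀ k l, Integrable (fun γ => ‖cubicTerm (coeff α γ) (n, k, l)‖ ^ 2)
      gaussianSequence := fun k l =>
    ((hasMoments_cubicTerm α (n, k, l)) 2).integrable_norm_pow two_ne_zero
  calc ∫ γ, ‖∑ p ∈ resonantIndex N n, cubicTerm (coeff α γ) p‖ ^ 2 ∂gaussianSequence
      ≤ ∫ γ, 4 * ∑ k ∈ Finset.range N, ∑ l ∈ Finset.range N,
          ‖cubicTerm (coeff α γ) (n, k, l)‖ ^ 2 ∂gaussianSequence := by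
        refine integral_mono_of_nonneg (ae_of_all _ fun γ => by positivity)
          ((integrable_finsetSum _ fun k _ => integrable_finsetSum _ fun l _ =>
            hint k l).const_mul 4) (ae_of_all _ fun γ => ?_)
        refine (pow_le_pow_left₀ (norm_nonneg _) (norm_sum_resonantIndex_le N n _) 2).trans_eq ?_
        rw [mul_pow, mul_pow, sq (∑ k ∈ Finset.range N, ‖coeff α γ k‖ ^ 2), Finset.sum_mul_sum,
          Finset.mul_sum]
        norm_num
        refine Finset.sum_congr rfl fun k _ => ?_
        rw [Finset.mul_sum]
        refine Finset.sum_congr rfl fun l _ => ?_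
        simp only [cubicTerm, norm_mul, RCLike.norm_conj]
        ring
    _ = 4 * ∑ k ∈ Finset.range N, ∑ l ∈ Finset.range N,
          ∫ γ, ‖cubicTerm (coeff α γ) (n, k, l)‖ ^ 2 ∂gaussianSequence := by
        rw [integral_const_mul, integral_finsetSum _ fun k _ => integrable_finsetSum _ fun l _ =>
          hint k l]
        congr 1
        exact Finset.sum_congr rfl fun k _ => integral_finsetSum _ fun l _ => hint k l
    _ ≤ 4 * ∑ k ∈ Finset.range N, ∑ l ∈ Finset.range N,
          variance α n * variance α k * variance α l * absMoment 6 := by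
        gcongr with k _ l _
        exact integral_norm_cubicTerm_sq_le α (n, k, l)
    _ = _ := by
        rw [sq, Finset.sum_mul_sum]
        simp only [Finset.mul_sum, Finset.sum_mul]
        refine Finset.sum_congr rfl fun k _ => Finset.sum_congr rfl fun l _ => by ring

/-- From `k + m = n + l ≥ n`, one of `k`, `m` is at least `n / 2`, and its variance is at most a
constant times that of `n`. The other two frequencies determine it, so they can be summed freely. -/
lemma sum_cubicIndex_variance_le {α : ℝ} (hα : 0 < α) (N n : ℕ) :
    ∑ p ∈ cubicIndex N n, variance α p.1 * variance α p.2.1 * variance α p.2.2 ≤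
      2 * 2 ^ (2 * α) * (∑ k ∈ Finset.range N, variance α k) ^ 2 * variance α n := by
  have hv := fun n => variance_nonneg α n
  have h1 : ∑ p ∈ cubicIndex N n, variance α p.2.1 * variance α p.2.2 ≤
      (∑ k ∈ Finset.range N, variance α k) ^ 2 := by
    rw [sq, Finset.sum_mul_sum, ← Finset.sum_product']
    refine sum_comp_le_of_injOn (f := fun p : ℕ × ℕ × ℕ => p.2)
      (h := fun q : ℕ × ℕ => variance α q.1 * variance α q.2) ?_ ?_
      fun q => mul_nonneg (hv _) (hv _)
    · intro p hp q hq hpq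
      have hp1 := (mem_cubicIndex.1 hp).2
      have hq1 := (mem_cubicIndex.1 hq).2
      obtain ⟨h2, h3⟩ := Prod.ext_iff.1 hpq
      beta_reduce at h2 h3
      ext <;> omega
    · intro p hp
      obtain ⟨⟨-, hp⟩, -⟩ := mem_cubicIndex.1 hp
      simpa using hp
  have h2 : ∑ p ∈ cubicIndex N n, variance α p.1 * variance α p.2.1 ≤
      (∑ k ∈ Finset.range N, variance α k) ^ 2 := by
    rw [sq, Finset.sum_mul_sum, ← Finset.sum_product']
    refine sum_comp_le_of_injOn (f := fun p : ℕ × ℕ × ℕ => (p.1, p.2.1))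
      (h := fun q : ℕ × ℕ => variance α q.1 * variance α q.2) ?_ ?_
      fun q => mul_nonneg (hv _) (hv _)
    · intro p hp q hq hpq
      have hp1 := (mem_cubicIndex.1 hp).2
      have hq1 := (mem_cubicIndex.1 hq).2
      obtain ⟨h2, h3⟩ := Prod.ext_iff.1 hpq
      simp only at h2 h3
      ext <;> omega
    · intro p hp
      obtain ⟨hp, -⟩ := mem_cubicIndex.1 hp
      simpa using ⟨hp.1, hp.2.1⟩
  have h3 : ∀ p ∈ cubicIndex N n, variance α p.1 * variance α p.2.1 * variance α p.2.2 ≤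
      2 ^ (2 * α) * variance α n * (variance α p.2.1 * variance α p.2.2 +
        variance α p.1 * variance α p.2.1) := by
    intro p hp
    have hp1 := (mem_cubicIndex.1 hp).2
    have h12 := mul_nonneg (hv p.1) (hv p.2.1)
    have h23 := mul_nonneg (hv p.2.1) (hv p.2.2)
    have hc : 0 ≤ 2 ^ (2 * α) * variance α n := mul_nonneg (by positivity) (hv n)
    rcases (by omega : n ≤ 2 * p.1 ∨ n ≤ 2 * p.2.2) with h | h
    · have := mul_le_mul_of_nonneg_right (variance_le hα h) h23
      nlinarith [mul_nonneg hc h12]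
    · have := mul_le_mul_of_nonneg_left (variance_le hα h) h12
      nlinarith [mul_nonneg hc h23]
  calc _ ≤ _ := Finset.sum_le_sum h3
    _ = 2 ^ (2 * α) * variance α n * (∑ p ∈ cubicIndex N n, variance α p.2.1 * variance α p.2.2 +
        ∑ p ∈ cubicIndex N n, variance α p.1 * variance α p.2.1) := by
      rw [← Finset.mul_sum, Finset.sum_add_distrib]
    _ ≤ 2 ^ (2 * α) * variance α n * ((∑ k ∈ Finset.range N, variance α k) ^ 2 +
        (∑ k ∈ Finset.range N, variance α k) ^ 2) :=
      mul_le_mul_of_nonneg_left (add_le_add h1 h2) (mul_nonneg (by positivity) (hv n))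
    _ = _ := by ring

/-- Non-resonant monomials with different frequencies are uncorrelated. -/
lemma integral_cubicTerm_mul_conj_eq_zero (α : ℝ) {p q : ℕ × ℕ × ℕ}
    (hp : ¬ (p.2.1 = p.1 ∨ p.2.1 = p.2.2)) (hq : ¬ (q.2.1 = q.1 ∨ q.2.1 = q.2.2))
    (h : ¬ (q = p ∨ q = (p.2.2, p.2.1, p.1))) :
    ∫ γ, cubicTerm (coeff α γ) p * conj (cubicTerm (coeff α γ) q) ∂gaussianSequence = 0 := by
  have hc : ∀ p : ℕ × ℕ × ℕ, HasCharge (fun γ => cubicTerm (coeff α γ) p) _ := fun p =>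
    ((hasCharge_coeff α p.1).mul (hasCharge_coeff α p.2.1).conj).mul (hasCharge_coeff α p.2.2)
  have hex : ∃ j : ℕ, ¬ (4 : ℤ) ∣ ((if p.1 = j then 1 else 0) + -(if p.2.1 = j then 1 else 0) +
      (if p.2.2 = j then 1 else 0)) + -((if q.1 = j then 1 else 0) +
        -(if q.2.1 = j then 1 else 0) + (if q.2.2 = j then 1 else 0)) := by
    by_contra! hall
    obtain ⟨k, l, m⟩ := p
    obtain ⟨k', l', m'⟩ := q
    simp only [Prod.mk.injEq] at h hp hq hall
    have h1 := hall k
    have h2 := hall l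
    have h3 := hall m
    clear hall
    -- Without resonance the charge of `p` at `l` is exactly `-1`; if `l' ≠ l`, that of `q` there is
    -- 0, 1 or 2, and the difference is not divisible by 4. Once `l' = l`, the positive charges
    -- identify `{k, m}`.
    have hl : l' = l := by grind
    subst hl
    grind
  obtain ⟨j, hj⟩ := hex
  exact ((hc p).mul (hc q).conj).integral_eq_zero ((hasMoments_cubicTerm α p).mul
    (hasMoments_cubicTerm α q).conj).integrable.aestronglyMeasurable hj

lemma integral_norm_sum_nonresonantIndex_sq_le {α : ℝ} (hα : 0 < α) (N n : ℕ) :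
    ∫ γ, ‖∑ p ∈ nonresonantIndex N n, cubicTerm (coeff α γ) p‖ ^ 2 ∂gaussianSequence ≤
      4 * 2 ^ (2 * α) * absMoment 6 * (∑ k ∈ Finset.range N, variance α k) ^ 2 * variance α n := by
  have hmem : ∀ p ∈ nonresonantIndex N n, ¬ (p.2.1 = p.1 ∨ p.2.1 = p.2.2) := fun p hp =>
    (Finset.mem_filter.1 hp).2
  have h := integral_norm_sq_sum_le (P := gaussianSequence) (nonresonantIndex N n)
    (fun p γ => cubicTerm (coeff α γ) p) (fun p _ => (hasMoments_cubicTerm α p).memLp_two)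
    (fun p q => q = p ∨ q = (p.2.2, p.2.1, p.1)) (by rintro p q (rfl | rfl) <;> simp)
    (fun p hp q hq hpq => integral_cubicTerm_mul_conj_eq_zero α (hmem p hp) (hmem q hq) hpq) 2
    (fun p _ => by
      refine (Finset.card_le_card (t := {p, (p.2.2, p.2.1, p.1)}) fun q hq => ?_).trans
        Finset.card_le_two
      rw [Finset.mem_filter] at hq
      simpa using hq.2)
  have hv := fun n => variance_nonneg α n
  calc _ ≤ _ := h
    _ ≤ (2 : ℕ) * ∑ p ∈ nonresonantIndex N n,
        variance α p.1 * variance α p.2.1 * variance α p.2.2 * absMoment 6 := by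
      gcongr with p _
      exact integral_norm_cubicTerm_sq_le α p
    _ ≤ (2 : ℕ) * ∑ p ∈ cubicIndex N n,
        variance α p.1 * variance α p.2.1 * variance α p.2.2 * absMoment 6 := by
      refine mul_le_mul_of_nonneg_left ?_ (Nat.cast_nonneg 2)
      refine Finset.sum_le_sum_of_subset_of_nonneg (Finset.filter_subset _ _) fun p _ _ => ?_
      exact mul_nonneg (mul_nonneg (mul_nonneg (hv _) (hv _)) (hv _)) (absMoment_nonneg 6)
    _ ≤ (2 : ℕ) * ((2 * 2 ^ (2 * α) * (∑ k ∈ Finset.range N, variance α k) ^ 2 * variance α n) *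
        absMoment 6) := by
      rw [← Finset.sum_mul]
      have := absMoment_nonneg 6
      gcongr
      exact sum_cubicIndex_variance_le hα N n
    _ = _ := by push_cast; ring

/-- The second moment of the `n`-th Fourier coefficient of the cubic term is of the order of that
of the initial datum, uniformly in the truncation. -/
lemma exists_lintegral_enorm_cubicSum_sq_le {α : ℝ} (hα : 1 / 2 < α) :
    ∃ C : ℝ, 0 ≤ C ∧ ∀ N n : ℕ, ∫⁻ γ, ‖cubicSum N n (coeff α γ)‖ₑ ^ 2 ∂gaussianSequence ≤
      ENNReal.ofReal (C * variance α n) := by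
  have hv := fun n => variance_nonneg α n
  have hM := absMoment_nonneg 6
  refine ⟨(8 + 8 * 2 ^ (2 * α)) * absMoment 6 * (∑' k, variance α k) ^ 2, by positivity,
    fun N n => ?_⟩
  have hR : HasMoments fun γ => ∑ p ∈ resonantIndex N n, cubicTerm (coeff α γ) p :=
    hasMoments_sum _ (hasMoments_cubicTerm α)
  have hNR : HasMoments fun γ => ∑ p ∈ nonresonantIndex N n, cubicTerm (coeff α γ) p :=
    hasMoments_sum _ (hasMoments_cubicTerm α)
  have hRi := (hR 2).integrable_norm_pow two_ne_zero
  have hNRi := (hNR 2).integrable_norm_pow two_ne_zero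
  have hσ : (∑ k ∈ Finset.range N, variance α k) ^ 2 ≤ (∑' k, variance α k) ^ 2 :=
    pow_le_pow_left₀ (Finset.sum_nonneg fun k _ => hv k)
      ((summable_variance hα).sum_le_tsum _ fun k _ => hv k) 2
  have h1 : ∫ γ, ‖cubicSum N n (coeff α γ)‖ ^ 2 ∂gaussianSequence ≤
      (8 + 8 * 2 ^ (2 * α)) * absMoment 6 * (∑' k, variance α k) ^ 2 * variance α n := by
    calc ∫ γ, ‖cubicSum N n (coeff α γ)‖ ^ 2 ∂gaussianSequence
        ≤ ∫ γ, 2 * ‖∑ p ∈ resonantIndex N n, cubicTerm (coeff α γ) p‖ ^ 2 +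
            2 * ‖∑ p ∈ nonresonantIndex N n, cubicTerm (coeff α γ) p‖ ^ 2 ∂gaussianSequence := by
          refine integral_mono_of_nonneg (ae_of_all _ fun γ => by positivity)
            ((hRi.const_mul 2).add (hNRi.const_mul 2)) (ae_of_all _ fun γ => ?_)
          have hsplit : cubicSum N n (coeff α γ) =
              ∑ p ∈ resonantIndex N n, cubicTerm (coeff α γ) p +
                ∑ p ∈ nonresonantIndex N n, cubicTerm (coeff α γ) p :=
            (Finset.sum_filter_add_sum_filter_not _ _ _).symm
          simp only [hsplit]
          have h2 := norm_add_le (∑ p ∈ resonantIndex N n, cubicTerm (coeff α γ) p)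
            (∑ p ∈ nonresonantIndex N n, cubicTerm (coeff α γ) p)
          refine (pow_le_pow_left₀ (norm_nonneg _) h2 2).trans ?_
          linarith [add_sq_le (a := ‖∑ p ∈ resonantIndex N n, cubicTerm (coeff α γ) p‖)
            (b := ‖∑ p ∈ nonresonantIndex N n, cubicTerm (coeff α γ) p‖)]
      _ = 2 * ∫ γ, ‖∑ p ∈ resonantIndex N n, cubicTerm (coeff α γ) p‖ ^ 2 ∂gaussianSequence +
            2 * ∫ γ, ‖∑ p ∈ nonresonantIndex N n, cubicTerm (coeff α γ) p‖ ^ 2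
              ∂gaussianSequence := by
          rw [integral_add (hRi.const_mul 2) (hNRi.const_mul 2), integral_const_mul,
            integral_const_mul]
      _ ≤ 2 * (4 * absMoment 6 * (∑ k ∈ Finset.range N, variance α k) ^ 2 * variance α n) +
            2 * (4 * 2 ^ (2 * α) * absMoment 6 * (∑ k ∈ Finset.range N, variance α k) ^ 2 *
              variance α n) := by
          gcongr
          · exact integral_norm_sum_resonantIndex_sq_le α N n
          · exact integral_norm_sum_nonresonantIndex_sq_le (by linarith) N n
      _ = (8 + 8 * 2 ^ (2 * α)) * absMoment 6 * (∑ k ∈ Finset.range N, variance α k) ^ 2 *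
            variance α n := by ring
      _ ≤ _ := by
          have := hv n
          gcongr
  refine le_trans (le_of_eq ?_) (ENNReal.ofReal_le_ofReal h1)
  rw [ofReal_integral_eq_lintegral_ofReal
    ((hasMoments_cubicSum α N n 2).integrable_norm_pow two_ne_zero)
    (ae_of_all _ fun γ => by positivity)]
  refine lintegral_congr fun γ => ?_
  rw [ENNReal.ofReal_pow (norm_nonneg _), ofReal_norm]

/-! ### Sobolev energies -/

/-- The square of the `H^s` norm. -/
def energy (s : ℝ) (c : ℤ → ℂ) : ℝ≥0∞ :=
  ∑' n : ℤ, (ENNReal.ofReal ((1 + |(n : ℝ)|) ^ s) * ‖c n‖ₑ) ^ 2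

lemma sobolevNorm_eq (s : ℝ) (c : ℤ → ℂ) : sobolevNorm s c = energy s c ^ (1 / 2 : ℝ) := rfl

lemma sobolevNorm_lt_top_iff {s : ℝ} {c : ℤ → ℂ} : sobolevNorm s c < ∞ ↔ energy s c < ∞ := by
  rw [sobolevNorm_eq, ENNReal.rpow_lt_top_iff_of_pos (by norm_num)]

lemma sobolevNorm_eq_top_iff {s : ℝ} {c : ℤ → ℂ} : sobolevNorm s c = ∞ ↔ energy s c = ∞ := by
  rw [sobolevNorm_eq, ENNReal.rpow_eq_top_iff_of_pos (by norm_num)]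

lemma energy_mono_index {s t : ℝ} (h : s ≤ t) (c : ℤ → ℂ) : energy s c ≤ energy t c := by
  refine ENNReal.tsum_le_tsum fun n => ?_
  have : (1 : ℝ) ≤ 1 + |(n : ℝ)| := by linarith [abs_nonneg (n : ℝ)]
  gcongr

lemma energy_mono {s : ℝ} {c d : ℤ → ℂ} (h : ∀ n, ‖c n‖ₑ ≤ ‖d n‖ₑ) : energy s c ≤ energy s d := by
  refine ENNReal.tsum_le_tsum fun n => ?_
  gcongr
  exact h n

lemma energy_const_mul (s : ℝ) (b : ℂ) (c : ℤ → ℂ) :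
    energy s (fun n => b * c n) = ‖b‖ₑ ^ 2 * energy s c := by
  rw [energy, energy, ← ENNReal.tsum_mul_left]
  refine tsum_congr fun n => ?_
  rw [enorm_mul]
  ring

lemma energy_add_le (s : ℝ) (c d : ℤ → ℂ) :
    energy s (fun n => c n + d n) ≤ 2 * energy s c + 2 * energy s d := by
  rw [energy, energy, energy, ← ENNReal.tsum_mul_left, ← ENNReal.tsum_mul_left,
    ← ENNReal.tsum_add]
  refine ENNReal.tsum_le_tsum fun n => ?_
  have h := ENNReal.rpow_add_le_mul_rpow_add_rpow (ENNReal.ofReal ((1 + |(n : ℝ)|) ^ s) * ‖c n‖ₑ)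
    (ENNReal.ofReal ((1 + |(n : ℝ)|) ^ s) * ‖d n‖ₑ) (p := 2) one_le_two
  rw [show (2 : ℝ) - 1 = 1 by norm_num, ENNReal.rpow_one] at h
  simp only [ENNReal.rpow_ofNat] at h
  rw [← mul_add]
  refine le_trans ?_ h
  rw [← mul_add]
  gcongr
  exact enorm_add_le _ _

lemma energy_add_lt_top {s : ℝ} {c d : ℤ → ℂ} (hc : energy s c < ∞) (hd : energy s d < ∞) :
    energy s (fun n => c n + d n) < ∞ :=
  (energy_add_le s c d).trans_lt (ENNReal.add_lt_top.2
    ⟨ENNReal.mul_lt_top ENNReal.ofNat_lt_top hc, ENNReal.mul_lt_top ENNReal.ofNat_lt_top hd⟩)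

lemma energy_const_mul_lt_top {s : ℝ} {c : ℤ → ℂ} (b : ℂ) (hc : energy s c < ∞) :
    energy s (fun n => b * c n) < ∞ := by
  rw [energy_const_mul]
  exact ENNReal.mul_lt_top (ENNReal.pow_lt_top enorm_lt_top) hc

/-! ### Boundedness below the exponent `α - 1/2` -/

/-- The Fourier coefficients of `|u₀|² u₀`. -/
def cubicFourier (α : ℝ) (γ : ℕ → ℂ) : ℤ → ℂ :=
  fourierCoeff (tripleProduct (initialDatum α γ) (initialDatum α γ) (initialDatum α γ))

lemma duhamelOfData_initialDatum (α : ℝ) (γ : ℕ → ℂ) (t : ℝ) :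
    duhamelOfData (initialDatum α γ) t =
      fun n => (t : ℂ) * szegoProjector (cubicFourier α γ) n := by
  ext n
  simp [duhamelOfData, duhamel, cubicFourier]

lemma secondIterate_initialDatum {α : ℝ} {γ : ℕ → ℂ} (h : Summable (randomTerm α γ)) (t : ℝ) :
    secondIterate (initialDatum α γ) t = fun n => extendZero (coeff α γ) n +
      (-(Complex.I * t)) * szegoProjector (cubicFourier α γ) n := by
  ext n
  rw [secondIterate, fourierCoeff_initialDatum h, duhamelOfData_initialDatum]
  ring

lemma aemeasurable_cubicFourier {α : ℝ} (hα : 1 / 2 < α) (n : ℤ) :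
    AEMeasurable (fun γ => cubicFourier α γ n) gaussianSequence := by
  obtain ⟨φ, hφ⟩ := exists_tendsto_cubicSum hα
  refine aemeasurable_of_tendsto_metrizable_ae Filter.atTop
    (f := fun j γ => cubicSum (φ j) n (coeff α γ))
    (fun j => (hasMoments_cubicSum α (φ j) n).integrable.aemeasurable) ?_
  filter_upwards [hφ] with γ hγ using hγ.2.2 n

/-- Fatou's lemma along the almost surely convergent subsequence, the bound on truncations being
uniform. -/
lemma exists_lintegral_enorm_cubicFourier_sq_le {α : ℝ} (hα : 1 / 2 < α) :
    ∃ C : ℝ, 0 ≤ C ∧ ∀ n : ℕ, ∫⁻ γ, ‖cubicFourier α γ n‖ₑ ^ 2 ∂gaussianSequence ≤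
      ENNReal.ofReal (C * variance α n) := by
  obtain ⟨φ, hφ⟩ := exists_tendsto_cubicSum hα
  obtain ⟨C, hC0, hC⟩ := exists_lintegral_enorm_cubicSum_sq_le hα
  refine ⟨C, hC0, fun n => ?_⟩
  calc ∫⁻ γ, ‖cubicFourier α γ n‖ₑ ^ 2 ∂gaussianSequence
      = ∫⁻ γ, Filter.liminf (fun j => ‖cubicSum (φ j) n (coeff α γ)‖ₑ ^ 2) Filter.atTop
          ∂gaussianSequence := by
        refine lintegral_congr_ae ?_
        filter_upwards [hφ] with γ hγ
        exact ((ENNReal.continuous_pow 2).tendsto _ |>.comp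
          ((continuous_enorm.tendsto _).comp (hγ.2.2 n))).liminf_eq.symm
    _ ≤ Filter.liminf (fun j => ∫⁻ γ, ‖cubicSum (φ j) n (coeff α γ)‖ₑ ^ 2 ∂gaussianSequence)
          Filter.atTop :=
        lintegral_liminf_le' fun j =>
          ((hasMoments_cubicSum α (φ j) n).integrable.aemeasurable.enorm.pow_const 2)
    _ ≤ ENNReal.ofReal (C * variance α n) :=
        Filter.liminf_le_of_le (by isBoundedDefault) fun b hb => by
          obtain ⟨j, hj⟩ := hb.exists
          exact hj.trans (hC (φ j) n)

lemma variance_le_rpow {α : ℝ} (hα : 0 < α) (n : ℕ) :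
    variance α n ≤ 2 ^ (2 * α) * (1 + (n : ℝ)) ^ (-(2 * α)) := by
  have h2 : (1 : ℝ) ≤ 2 ^ (2 * α) := Real.one_le_rpow one_le_two (by linarith)
  have h : (1 + (n : ℝ)) ^ (2 * α) ≤ 2 ^ (2 * α) * (1 + (n : ℝ) ^ (2 * α)) := by
    rcases Nat.eq_zero_or_pos n with rfl | hn
    · have : (0 : ℝ) ^ (2 * α) = 0 := Real.zero_rpow (by linarith)
      simpa [this] using h2
    · have hn' : (1 : ℝ) ≤ n := by exact_mod_cast hn
      calc (1 + (n : ℝ)) ^ (2 * α) ≤ (2 * n) ^ (2 * α) :=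
            Real.rpow_le_rpow (by positivity) (by linarith) (by linarith)
        _ = 2 ^ (2 * α) * (n : ℝ) ^ (2 * α) := Real.mul_rpow zero_le_two (Nat.cast_nonneg n)
        _ ≤ _ := by gcongr; linarith
  rw [variance, Real.rpow_neg (by positivity), ← div_eq_mul_inv,
    div_le_div_iff₀ (by positivity) (by positivity)]
  linarith

/-- A random distribution with frequencies `n ≥ 0` whose coefficients have second moments of order
`1 / (1 + n ^ (2α))` is almost surely in `H^s` for `s < α - 1/2`. -/
lemma ae_energy_extendZero_lt_top {α s : ℝ} (hα : 1 / 2 < α) (hs : s < α - 1 / 2)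
    {X : ℕ → (ℕ → ℂ) → ℂ} (hX : ∀ n, AEMeasurable (X n) gaussianSequence) {C : ℝ} (hC : 0 ≤ C)
    (h : ∀ n : ℕ, ∫⁻ γ, ‖X n γ‖ₑ ^ 2 ∂gaussianSequence ≤ ENNReal.ofReal (C * variance α n)) :
    ∀ᵐ γ ∂gaussianSequence, energy s (extendZero fun n => X n γ) < ∞ := by
  -- The general term is of order `n ^ (2s - 2α)`, and `2α - 2s > 1` is exactly `s < α - 1/2`.
  have hsum : Summable fun n : ℕ => (1 + (n : ℝ)) ^ (2 * s) * (C * variance α n) := by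
    have h1 : Summable fun n : ℕ => C * 2 ^ (2 * α) * (1 / ((n + 1 : ℕ) : ℝ) ^ (2 * α - 2 * s)) :=
      ((summable_nat_add_iff 1).2
        (Real.summable_one_div_nat_rpow.2 (by linarith : 1 < 2 * α - 2 * s))).mul_left _
    refine Summable.of_nonneg_of_le (fun n => mul_nonneg (by positivity)
      (mul_nonneg hC (variance_nonneg α n))) (fun n => ?_) h1
    have hn : (0 : ℝ) < 1 + n := by positivity
    calc (1 + (n : ℝ)) ^ (2 * s) * (C * variance α n)
        ≤ (1 + (n : ℝ)) ^ (2 * s) * (C * (2 ^ (2 * α) * (1 + (n : ℝ)) ^ (-(2 * α)))) := by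
          gcongr
          exact variance_le_rpow (by linarith) n
      _ = C * 2 ^ (2 * α) * ((1 + (n : ℝ)) ^ (2 * s) * (1 + (n : ℝ)) ^ (-(2 * α))) := by ring
      _ = _ := by
          rw [← Real.rpow_add hn, one_div, ← Real.rpow_neg (by positivity)]
          push_cast
          rw [add_comm (n : ℝ) 1]
          congr 2
          ring
  have hkey := ae_tsum_ne_top (P := gaussianSequence)
    (X := fun (n : ℕ) γ => ENNReal.ofReal ((1 + (n : ℝ)) ^ (2 * s)) * ‖X n γ‖ₑ ^ 2)
    (w := fun n : ℕ => (1 + (n : ℝ)) ^ (2 * s) * (C * variance α n))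
    (fun n => ((hX n).enorm.pow_const 2).const_mul _)
    (fun n => mul_nonneg (by positivity) (mul_nonneg hC (variance_nonneg α n))) hsum (fun n => by
      rw [lintegral_const_mul'' _ ((hX n).enorm.pow_const 2), ENNReal.ofReal_mul (by positivity)]
      gcongr
      exact h n)
  filter_upwards [hkey] with γ hγ
  have h1 : energy s (extendZero fun n => X n γ) =
      ∑' n : ℕ, ENNReal.ofReal ((1 + (n : ℝ)) ^ (2 * s)) * ‖X n γ‖ₑ ^ 2 := by
    rw [energy, ← (Nat.cast_injective (R := ℤ)).tsum_eq]
    · refine tsum_congr fun n => ?_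
      have h2 : ((1 + (n : ℝ)) ^ s) ^ 2 = (1 + (n : ℝ)) ^ (2 * s) := by
        rw [← Real.rpow_natCast, ← Real.rpow_mul (by positivity)]
        congr 1
        push_cast; ring
      simp only [extendZero, Nat.cast_nonneg, if_true, Int.toNat_natCast, Int.cast_natCast,
        Nat.abs_cast]
      rw [mul_pow, ← ENNReal.ofReal_pow (by positivity), h2]
    · intro n hn
      by_contra hneg
      refine hn ?_
      have : ¬ 0 ≤ n := fun h0 => hneg ⟨n.toNat, Int.toNat_of_nonneg h0⟩
      simp [extendZero, this]
  rw [h1]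
  exact hγ.lt_top

lemma szegoProjector_eq_extendZero (c : ℤ → ℂ) :
    szegoProjector c = extendZero fun n => c n := by
  ext n
  rw [szegoProjector, extendZero]
  split_ifs with h
  · rw [Int.toNat_of_nonneg h]
  · rfl

lemma ae_energy_coeff_lt_top {α s : ℝ} (hα : 1 / 2 < α) (hs : s < α - 1 / 2) :
    ∀ᵐ γ ∂gaussianSequence, energy s (extendZero (coeff α γ)) < ∞ := by
  refine ae_energy_extendZero_lt_top hα hs (X := fun n γ => coeff α γ n)
    (fun n => (hasMoments_coeff α n).integrable.aemeasurable) (absMoment_nonneg 2) fun n => ?_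
  have h1 : ∫ γ, ‖coeff α γ n‖ ^ 2 ∂gaussianSequence = absMoment 2 * variance α n := by
    simp_rw [norm_coeff_sq]
    rw [integral_const_mul, integral_norm_pow_eval, mul_comm]
  rw [← h1, ofReal_integral_eq_lintegral_ofReal
    ((hasMoments_coeff α n 2).integrable_norm_pow two_ne_zero)
    (ae_of_all _ fun γ => by positivity)]
  refine le_of_eq (lintegral_congr fun γ => ?_)
  rw [ENNReal.ofReal_pow (norm_nonneg _), ofReal_norm]

lemma ae_energy_cubicFourier_lt_top {α s : ℝ} (hα : 1 / 2 < α) (hs : s < α - 1 / 2) :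
    ∀ᵐ γ ∂gaussianSequence, energy s (szegoProjector (cubicFourier α γ)) < ∞ := by
  obtain ⟨C, hC0, hC⟩ := exists_lintegral_enorm_cubicFourier_sq_le hα
  simp_rw [szegoProjector_eq_extendZero]
  exact ae_energy_extendZero_lt_top hα hs (X := fun n γ => cubicFourier α γ n)
    (fun n => aemeasurable_cubicFourier hα n) hC0 hC

/-- The second iterate is almost surely bounded in `H^s_+` on bounded time intervals, for
`s < α - 1/2`. -/
lemma ae_secondIterate_bounded {α s : ℝ} (hα : 1 / 2 < α) (hs : s < α - 1 / 2) :
    ∀ᵐ γ ∂gaussianSequence, ∀ T : ℝ,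
      (∀ t ∈ Set.Icc (-T) T, MemSobolevPlus s (secondIterate (initialDatum α γ) t)) ∧
        supSobolevNorm T s (secondIterate (initialDatum α γ)) < ∞ := by
  obtain ⟨φ, hφ⟩ := exists_tendsto_cubicSum hα
  filter_upwards [hφ, ae_energy_coeff_lt_top hα hs, ae_energy_cubicFourier_lt_top hα hs]
    with γ hγ h1 h2 T
  have hsum := hγ.1
  set B : ℝ≥0∞ := 2 * energy s (extendZero (coeff α γ)) +
    2 * (ENNReal.ofReal T ^ 2 * energy s (szegoProjector (cubicFourier α γ)))
  have hB : B < ∞ := ENNReal.add_lt_top.2 ⟨ENNReal.mul_lt_top ENNReal.ofNat_lt_top h1,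
    ENNReal.mul_lt_top ENNReal.ofNat_lt_top
      (ENNReal.mul_lt_top (ENNReal.pow_lt_top ENNReal.ofReal_lt_top) h2)⟩
  have hle : ∀ t ∈ Set.Icc (-T) T, energy s (secondIterate (initialDatum α γ) t) ≤ B := by
    intro t ht
    rw [secondIterate_initialDatum hsum]
    refine (energy_add_le _ _ _).trans ?_
    rw [energy_const_mul]
    simp only [B]
    gcongr
    rw [enorm_neg, enorm_mul, ← ofReal_norm, Complex.norm_I, ENNReal.ofReal_one, one_mul,
      ← ofReal_norm, Complex.norm_real, Real.norm_eq_abs]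
    exact ENNReal.ofReal_le_ofReal (abs_le.2 ht)
  refine ⟨fun t ht => ⟨fun n hn => ?_, sobolevNorm_lt_top_iff.2 ((hle t ht).trans_lt hB)⟩, ?_⟩
  · rw [secondIterate_initialDatum hsum]
    simp [extendZero, szegoProjector, hn.not_ge]
  · refine lt_of_le_of_lt (iSup₂_le fun t ht => ?_)
      (ENNReal.rpow_lt_top_of_nonneg (by norm_num : (0 : ℝ) ≤ 1 / 2) hB.ne)
    rw [sobolevNorm_eq]
    exact ENNReal.rpow_le_rpow (hle t ht) (by norm_num)

/-! ### Divergence at the exponent `α - 1/2` by resampling the mean -/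

/-- The initial datum stripped of its mean is not in `H^s` for `s = α - 1/2`. -/
lemma energy_coeff_eq_top {α : ℝ} (hα : 0 < α) {γ : ℕ → ℂ}
    (h : ¬ Summable fun n : ℕ => ‖γ n‖ ^ 2 / ((n : ℝ) + 1)) :
    energy (α - 1 / 2) (fun n => if 1 ≤ n then extendZero (coeff α γ) n else 0) = ∞ := by
  by_contra hne
  refine h ((summable_nat_add_iff 1).1 ?_)
  have h1 := (ENNReal.summable_toReal hne).comp_injective
    (i := fun n : ℕ => ((n + 1 : ℕ) : ℤ)) fun a b hab => by
      simpa using hab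
  refine Summable.of_nonneg_of_le (fun n => by positivity) (fun n => ?_) (h1.mul_left 2)
  have hn : (0 : ℝ) < 1 + ((n + 1 : ℕ) : ℝ) := by positivity
  -- With `m = n + 1`, this gives `(1 + m)^(2α - 1) / (1 + m^(2α)) ≥ 1 / (2 (1 + m))`, whence the
  -- factor 2 in the comparison.
  have h2 : (1 + ((n + 1 : ℕ) : ℝ) ^ (2 * α)) ≤ 2 * (1 + ((n + 1 : ℕ) : ℝ)) ^ (2 * α) := by
    have h3 : ((n + 1 : ℕ) : ℝ) ^ (2 * α) ≤ (1 + ((n + 1 : ℕ) : ℝ)) ^ (2 * α) :=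
      Real.rpow_le_rpow (by positivity) (by linarith) (by linarith)
    have h4 : 1 ≤ (1 + ((n + 1 : ℕ) : ℝ)) ^ (2 * α) :=
      Real.one_le_rpow (by linarith [Nat.cast_nonneg (α := ℝ) (n + 1)]) (by linarith)
    linarith
  have h5 : ((1 + ((n + 1 : ℕ) : ℝ)) ^ (α - 1 / 2)) ^ 2 * (1 + ((n + 1 : ℕ) : ℝ)) =
      (1 + ((n + 1 : ℕ) : ℝ)) ^ (2 * α) := by
    rw [← Real.rpow_natCast, ← Real.rpow_mul hn.le]
    nth_rewrite 2 [← Real.rpow_one (1 + ((n + 1 : ℕ) : ℝ))]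
    rw [← Real.rpow_add hn]
    congr 1
    push_cast; ring
  have hif : (1 : ℤ) ≤ ((n + 1 : ℕ) : ℤ) := by push_cast; omega
  simp only [Function.comp, if_pos hif, extendZero, Int.natCast_nonneg, if_true,
    Int.toNat_natCast, Int.cast_natCast, Nat.abs_cast, ENNReal.toReal_pow, ENNReal.toReal_mul,
    toReal_enorm]
  rw [ENNReal.toReal_ofReal (by positivity), mul_pow, norm_coeff_sq, variance, add_comm _ (1 : ℝ)]
  set A := ((1 + ((n + 1 : ℕ) : ℝ)) ^ (α - 1 / 2)) ^ 2
  set V := (1 + ((n + 1 : ℕ) : ℝ) ^ (2 * α)) with hV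
  have hVpos : 0 < V := by positivity
  have h6 : 1 / (1 + ((n + 1 : ℕ) : ℝ)) ≤ 2 * (A * (1 / V)) := by
    rw [mul_one_div, mul_div_assoc', div_le_div_iff₀ hn hVpos]
    rw [← h5] at h2
    linarith
  calc ‖γ (n + 1)‖ ^ 2 / (1 + ((n + 1 : ℕ) : ℝ))
      = 1 / (1 + ((n + 1 : ℕ) : ℝ)) * ‖γ (n + 1)‖ ^ 2 := by ring
    _ ≤ 2 * (A * (1 / V)) * ‖γ (n + 1)‖ ^ 2 := by gcongr
    _ = _ := by ring

lemma randomTerm_update {α : ℝ} (hα : 0 < α) (γ : ℕ → ℂ) (z : ℂ) (n : ℕ) :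
    randomTerm α (Function.update γ 0 z) n =
      randomTerm α γ n + if n = 0 then (z - γ 0) • fourierLp 2 0 else 0 := by
  rcases eq_or_ne n 0 with rfl | hn
  · have : (0 : ℝ) ^ (2 * α) = 0 := Real.zero_rpow (by linarith)
    simp only [randomTerm, Function.update_self, if_true, Nat.cast_zero, this, add_zero,
      Real.sqrt_one, Complex.ofReal_one, div_one]
    rw [← add_smul]
    congr 1
    ring
  · simp [randomTerm, hn]

lemma hasSum_randomTerm_update {α : ℝ} (hα : 0 < α) {γ : ℕ → ℂ} (h : Summable (randomTerm α γ))
    (z : ℂ) : HasSum (randomTerm α (Function.update γ 0 z))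
      (initialDatum α γ + (z - γ 0) • fourierLp 2 0) := by
  simp_rw [funext fun n => randomTerm_update hα γ z n]
  exact h.hasSum.add (hasSum_ite_eq 0 _)

lemma initialDatum_update_ae {α : ℝ} (hα : 0 < α) {γ : ℕ → ℂ} (h : Summable (randomTerm α γ))
    (z : ℂ) : initialDatum α (Function.update γ 0 z) =ᵐ[AddCircle.haarAddCircle]
      fun x => initialDatum α γ x + (z - γ 0) := by
  rw [initialDatum, (hasSum_randomTerm_update hα h z).tsum_eq]
  filter_upwards [Lp.coeFn_add (initialDatum α γ) ((z - γ 0) • fourierLp 2 0),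
    Lp.coeFn_smul (z - γ 0) (fourierLp (T := 2 * Real.pi) 2 0),
    coeFn_fourierLp (T := 2 * Real.pi) 2 0] with x h1 h2 h3
  rw [h1, Pi.add_apply, h2, Pi.smul_apply, h3, fourier_zero, smul_eq_mul, mul_one]

lemma fourierCoeff_conj (f : Torus → ℂ) (n : ℤ) :
    fourierCoeff (fun x => conj (f x)) n = conj (fourierCoeff f (-n)) := by
  rw [fourierCoeff, fourierCoeff, ← integral_conj]
  refine integral_congr_ae (ae_of_all _ fun x => ?_)
  simp only [smul_eq_mul, map_mul, neg_neg, fourier_neg]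

/-- The Fourier coefficients of `|h + x|² (h + x)` are cubic polynomials of the real number `x`. -/
lemma fourierCoeff_tripleProduct_add_real {h : Torus → ℂ} (hh : MemLp h 4 AddCircle.haarAddCircle)
    (x : ℝ) {n : ℤ} (hn : n ≠ 0) :
    fourierCoeff (tripleProduct (fun y => h y + x) (fun y => h y + x) (fun y => h y + x)) n =
      fourierCoeff (tripleProduct h h h) n +
        x * fourierCoeff (fun y => h y * h y + 2 * (h y * conj (h y))) n +
        (x : ℂ) ^ 2 * (2 * fourierCoeff h n + conj (fourierCoeff h (-n))) := by
  have hh2 : MemLp h 2 AddCircle.haarAddCircle := hh.mono_exponent (by norm_num)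
  have h1 : Integrable h AddCircle.haarAddCircle := hh2.integrable one_le_two
  have h1' : Integrable (fun y => conj (h y)) AddCircle.haarAddCircle :=
    (MemLp.star hh2).integrable one_le_two
  have h2 : Integrable (fun y => h y * h y + 2 * (h y * conj (h y))) AddCircle.haarAddCircle :=
    (hh2.integrable_mul hh2).add ((hh2.integrable_mul hh2.star).const_mul 2)
  have h3 := integrable_tripleProduct hh
  -- As `x` is real it equals its conjugate, so the expansion is polynomial in `x`; the `x³` term is
  -- constant on the torus and disappears at `n ≠ 0`.
  have hexp : tripleProduct (fun y => h y + x) (fun y => h y + x) (fun y => h y + x) =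
      ((tripleProduct h h h + fun y => x * (h y * h y + 2 * (h y * conj (h y)))) +
        ((fun y => (2 * (x : ℂ) ^ 2) * h y) + fun y => (x : ℂ) ^ 2 * conj (h y))) +
        fun y => (x : ℂ) ^ 3 * fourier 0 y := by
    ext y
    simp only [tripleProduct, Pi.add_apply, map_add, Complex.conj_ofReal, fourier_zero]
    ring
  have h0 : Integrable (fun y : Torus => (x : ℂ) ^ 3 * fourier 0 y) AddCircle.haarAddCircle := by
    simp only [fourier_zero]
    exact integrable_const _
  have hA := h3.add (h2.const_mul (x : ℂ))
  have hB := (h1.const_mul (2 * (x : ℂ) ^ 2)).add (h1'.const_mul ((x : ℂ) ^ 2))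
  rw [hexp, fourierCoeff.add (hA.add hB) h0, fourierCoeff.add hA hB,
    fourierCoeff.add h3 (h2.const_mul _), fourierCoeff.add (h1.const_mul _) (h1'.const_mul _)]
  simp only [Pi.add_apply, fourierCoeff.const_mul, fourierCoeff_conj, fourierCoeff_fourier,
    Pi.single_eq_of_ne hn]
  ring

/-- The distribution `b u₀ + c Π(|u₀|² u₀)`. -/
def linearCombination (α : ℝ) (b c : ℂ) (γ : ℕ → ℂ) (n : ℤ) : ℂ :=
  b * extendZero (coeff α γ) n + c * szegoProjector (cubicFourier α γ) n

/-- The imaginary part `y` is absorbed into `h`. What matters is the explicit `x²` coefficient: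
`conj (û₀(-n))` vanishes since `u₀` has no negative frequencies. `A` and `B` will be eliminated. -/
lemma exists_linearCombination_update {α : ℝ} (hα : 0 < α) {γ : ℕ → ℂ}
    (hs : Summable (randomTerm α γ)) (hL : MemLp (initialDatum α γ) 4 AddCircle.haarAddCircle)
    (b c : ℂ) (y : ℝ) : ∃ A B : ℤ → ℂ, ∀ n : ℤ, 1 ≤ n → ∀ x : ℝ,
      linearCombination α b c (Function.update γ 0 (x + y * Complex.I)) n =
        A n + x * B n + (x : ℂ) ^ 2 * (2 * c * extendZero (coeff α γ) n) := by
  set d : ℂ := y * Complex.I - γ 0 with hd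
  set h : Torus → ℂ := fun t => initialDatum α γ t + d with hh
  have hL' : MemLp h 4 AddCircle.haarAddCircle := hL.add (memLp_const d)
  refine ⟨fun n => b * extendZero (coeff α γ) n + c * fourierCoeff (tripleProduct h h h) n,
    fun n => c * fourierCoeff (fun t => h t * h t + 2 * (h t * conj (h t))) n, fun n hn x => ?_⟩
  have hint : Integrable (initialDatum α γ) AddCircle.haarAddCircle :=
    hL.integrable (by norm_num)
  have hhn : ∀ m : ℤ, m ≠ 0 → fourierCoeff h m = extendZero (coeff α γ) m := fun m hm => by
    have h1 : h = (initialDatum α γ : Torus → ℂ) + fun t : Torus => d * fourier 0 t := by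
      ext t; simp [hh]
    rw [h1, fourierCoeff.add hint (by simp only [fourier_zero]; exact integrable_const _),
      Pi.add_apply, fourierCoeff.const_mul, fourierCoeff_fourier, Pi.single_eq_of_ne hm, mul_zero,
      add_zero, fourierCoeff_initialDatum hs]
  have hcoeff : extendZero (coeff α (Function.update γ 0 (x + y * Complex.I))) n =
      extendZero (coeff α γ) n := by
    have hn0 : n.toNat ≠ 0 := by omega
    simp [extendZero, coeff, hn0]
  have hcubic : cubicFourier α (Function.update γ 0 (x + y * Complex.I)) n =
      fourierCoeff (tripleProduct (fun t => h t + x) (fun t => h t + x) (fun t => h t + x)) n := by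
    refine congrFun (fourierCoeff_congr_ae ?_) n
    filter_upwards [initialDatum_update_ae hα hs (x + y * Complex.I)] with t ht
    have : initialDatum α (Function.update γ 0 (x + y * Complex.I)) t = h t + x := by
      rw [ht, hh, hd]; ring
    simp only [tripleProduct, this]
  have hneg : extendZero (coeff α γ) (-n) = 0 := if_neg (by omega)
  rw [linearCombination, hcoeff, szegoProjector, if_pos (by omega), hcubic,
    fourierCoeff_tripleProduct_add_real hL' x (by omega), hhn n (by omega), hhn (-n) (by omega),
    hneg, map_zero]
  ring

/-- For all but finitely many real shifts of the mean of the datum, `b u₀ + c Π(|u₀|² u₀)` is not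
in `H^s`, `s = α - 1/2`. -/
lemma finite_energy_linearCombination_update {α : ℝ} (hα : 0 < α) {γ : ℕ → ℂ}
    (hs : Summable (randomTerm α γ)) (hL : MemLp (initialDatum α γ) 4 AddCircle.haarAddCircle)
    (hdiv : ¬ Summable fun n : ℕ => ‖γ n‖ ^ 2 / ((n : ℝ) + 1)) (b : ℂ) {c : ℂ} (hc : c ≠ 0)
    (y : ℝ) : {x : ℝ | energy (α - 1 / 2) (linearCombination α b c
      (Function.update γ 0 (x + y * Complex.I))) ≠ ∞}.Finite := by
  obtain ⟨A, B, hAB⟩ := exists_linearCombination_update hα hs hL b c y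
  by_contra hinf
  obtain ⟨t, hts, ht3⟩ := Set.Infinite.exists_subset_card_eq hinf 3
  obtain ⟨x₁, x₂, x₃, h12, h13, h23, rfl⟩ := Finset.card_eq_three.1 ht3
  set W : ℝ → ℤ → ℂ := fun x => linearCombination α b c (Function.update γ 0 (x + y * Complex.I))
  have hW : ∀ x ∈ ({x₁, x₂, x₃} : Finset ℝ), energy (α - 1 / 2) (W x) < ∞ := fun x hx =>
    lt_top_iff_ne_top.2 (hts hx)
  have hW1 := hW x₁ (by simp)
  have hW2 := hW x₂ (by simp)
  have hW3 := hW x₃ (by simp)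
  have e12 : (x₁ : ℂ) - x₂ ≠ 0 := sub_ne_zero.2 (by exact_mod_cast h12)
  have e13 : (x₁ : ℂ) - x₃ ≠ 0 := sub_ne_zero.2 (by exact_mod_cast h13)
  have e23 : (x₂ : ℂ) - x₃ ≠ 0 := sub_ne_zero.2 (by exact_mod_cast h23)
  -- The weights are those of the second divided difference at `x₁, x₂, x₃`, divided by `2 c`: they
  -- annihilate `A + x B` and leave the coefficient of `u₀`.
  have hfin := energy_add_lt_top (energy_add_lt_top
    (energy_const_mul_lt_top (1 / (2 * c * ((x₁ - x₂) * (x₁ - x₃)))) hW1)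
    (energy_const_mul_lt_top (-1 / (2 * c * ((x₁ - x₂) * (x₂ - x₃)))) hW2))
    (energy_const_mul_lt_top (1 / (2 * c * ((x₁ - x₃) * (x₂ - x₃)))) hW3)
  refine ((energy_mono fun n => ?_).trans_lt hfin).ne (energy_coeff_eq_top hα hdiv)
  split_ifs with hn
  · refine le_of_eq (congrArg _ ?_)
    simp only [W, hAB n hn]
    field_simp
    ring
  · simp

lemma aemeasurable_energy_linearCombination {α : ℝ} (hα : 1 / 2 < α) (s : ℝ) (b c : ℂ) :
    AEMeasurable (fun γ => energy s (linearCombination α b c γ)) gaussianSequence := by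
  refine AEMeasurable.tsum fun n => (AEMeasurable.const_mul (AEMeasurable.enorm ?_) _).pow_const 2
  refine AEMeasurable.add (AEMeasurable.const_mul ?_ b) (AEMeasurable.const_mul ?_ c)
  · unfold extendZero
    split_ifs
    · exact (hasMoments_coeff α _).integrable.aemeasurable
    · exact aemeasurable_const
  · unfold szegoProjector
    split_ifs
    · exact aemeasurable_cubicFourier hα n
    · exact aemeasurable_const

/-- Resampling the real and imaginary parts of the `0`-th coordinate. -/
lemma measurePreserving_update_re_im :
    MeasurePreserving (fun p : ((ℕ → ℂ) × ℝ) × ℝ =>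
        Function.update p.1.1 0 ((p.2 : ℂ) + p.1.2 * Complex.I))
      ((gaussianSequence.prod (gaussianReal 0 (1 / 2))).prod (gaussianReal 0 (1 / 2)))
      gaussianSequence := by
  have h1 : MeasurePreserving (fun p : ℝ × ℝ => (p.2 : ℂ) + p.1 * Complex.I)
      ((gaussianReal 0 (1 / 2)).prod (gaussianReal 0 (1 / 2))) stdComplexGaussian :=
    MeasurePreserving.comp (g := fun p : ℝ × ℝ => (p.1 : ℂ) + p.2 * Complex.I)
      ⟨by fun_prop, rfl⟩ Measure.measurePreserving_swap
  have h2 := (MeasurePreserving.prod (MeasurePreserving.id gaussianSequence) h1).comp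
    (measurePreserving_prodAssoc gaussianSequence (gaussianReal 0 (1 / 2)) (gaussianReal 0 (1 / 2)))
  exact measurePreserving_update_zero.comp (Measure.measurePreserving_swap.comp h2)

/-- Almost surely `b u₀ + c Π(|u₀|² u₀)` is not in `H^s` for `s ≥ α - 1/2`, if `c ≠ 0`. -/
lemma ae_energy_linearCombination_eq_top {α s : ℝ} (hα : 1 / 2 < α) (hs : α - 1 / 2 ≤ s) (b : ℂ)
    {c : ℂ} (hc : c ≠ 0) :
    ∀ᵐ γ ∂gaussianSequence, energy s (linearCombination α b c γ) = ∞ := by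
  have hα0 : 0 < α := by linarith
  obtain ⟨φ, hφ⟩ := exists_tendsto_cubicSum hα
  have hm := aemeasurable_energy_linearCombination hα (α - 1 / 2) b c
  set G := fun γ => energy (α - 1 / 2) (linearCombination α b c γ)
  -- The energy is only almost everywhere measurable, while the converse part of Fubini needs a
  -- measurable set; the argument runs through a measurable version.
  obtain ⟨G', hG', hGG'⟩ := hm
  set Θ := fun p : ((ℕ → ℂ) × ℝ) × ℝ =>
    Function.update p.1.1 0 ((p.2 : ℂ) + p.1.2 * Complex.I)
  have hΘ : MeasurePreserving Θ _ gaussianSequence := measurePreserving_update_re_im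
  have hmk : MeasurableSet {γ | G' γ = ∞} := hG' (measurableSet_singleton ∞)
  have : NullSingletonClass (gaussianReal 0 (1 / 2)) :=
    nullSingletonClass_gaussianReal (by norm_num)
  have hgood : ∀ᵐ p ∂gaussianSequence.prod (gaussianReal 0 (1 / 2)),
      ∀ᵐ x ∂gaussianReal 0 (1 / 2), G (Θ (p, x)) = ∞ := by
    filter_upwards [Measure.quasiMeasurePreserving_fst.ae hφ,
      Measure.quasiMeasurePreserving_fst.ae ae_not_summable_norm_sq_div] with p h1 h2
    have h3 := finite_energy_linearCombination_update hα0 h1.1 h1.2.1 h2 b hc p.2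
    exact h3.measure_zero _
  have heq := Measure.ae_ae_of_ae_prod (hΘ.quasiMeasurePreserving.ae hGG')
  have hmk_top : ∀ᵐ γ ∂gaussianSequence, G' γ = ∞ := by
    rw [← hΘ.map_eq, ae_map_iff hΘ.measurable.aemeasurable hmk,
      Measure.ae_prod_iff_ae_ae (p := fun p => G' (Θ p) = ∞) (hΘ.measurable hmk)]
    filter_upwards [hgood, heq] with p h1 h2
    filter_upwards [h1, h2] with x h3 h4
    rw [← h4, h3]
  filter_upwards [hmk_top, hGG'] with γ h1 h2
  have h3 : G γ = ∞ := h2.trans h1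
  exact top_le_iff.1 (h3 ▸ energy_mono_index hs _)

/-! ### Divergence of the Duhamel term and of the second iterate -/

lemma ae_energy_coeff_eq_top {α s : ℝ} (hα : 1 / 2 < α) (hs : α - 1 / 2 ≤ s) :
    ∀ᵐ γ ∂gaussianSequence, energy s (extendZero (coeff α γ)) = ∞ := by
  filter_upwards [ae_not_summable_norm_sq_div] with γ hγ
  refine top_le_iff.1 (le_trans ?_ (energy_mono_index hs _))
  rw [← energy_coeff_eq_top (by linarith : 0 < α) hγ]
  refine energy_mono fun n => ?_
  split_ifs <;> simp

lemma ae_supSobolevNorm_duhamel_eq_top {α s : ℝ} (hα : 1 / 2 < α) (hs : α - 1 / 2 ≤ s) :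
    ∀ᵐ γ ∂gaussianSequence, ∀ T : ℝ, 0 < T →
      supSobolevNorm T s (duhamelOfData (initialDatum α γ)) = ∞ := by
  filter_upwards [ae_energy_linearCombination_eq_top hα hs 0 one_ne_zero] with γ hγ T hT
  have h1 : energy s (duhamelOfData (initialDatum α γ) T) = ∞ := by
    rw [duhamelOfData_initialDatum, energy_const_mul]
    have h2 : linearCombination α 0 1 γ = szegoProjector (cubicFourier α γ) := by
      ext n; simp [linearCombination]
    rw [← h2, hγ, ENNReal.mul_top]
    simp [hT.ne']
  refine top_le_iff.1 ?_
  rw [← sobolevNorm_eq_top_iff.2 h1]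
  exact le_iSup₂ (f := fun t (_ : t ∈ Set.Icc (-T) T) =>
    sobolevNorm s (duhamelOfData (initialDatum α γ) t)) T ⟨by linarith, le_rfl⟩

lemma ae_sobolevNorm_secondIterate_eq_top {α s : ℝ} (hα : 1 / 2 < α) (hs : α - 1 / 2 ≤ s) (t : ℝ) :
    ∀ᵐ γ ∂gaussianSequence, sobolevNorm s (secondIterate (initialDatum α γ) t) = ∞ := by
  obtain ⟨φ, hφ⟩ := exists_tendsto_cubicSum hα
  rcases eq_or_ne t 0 with rfl | ht
  -- At `t = 0` the cubic term has coefficient zero, but `z(0) = u₀` is already outside `H^s`.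
  · filter_upwards [hφ, ae_energy_coeff_eq_top hα hs] with γ h1 h2
    rw [sobolevNorm_eq_top_iff, secondIterate_initialDatum h1.1]
    simpa using h2
  · have hc : -(Complex.I * (t : ℂ)) ≠ 0 := by simp [ht]
    filter_upwards [hφ, ae_energy_linearCombination_eq_top hα hs 1 hc] with γ h1 h2
    rw [sobolevNorm_eq_top_iff, secondIterate_initialDatum h1.1, ← h2]
    congr 1
    ext n
    simp [linearCombination]

lemma ae_supSobolevNorm_secondIterate_eq_top {α s : ℝ} (hα : 1 / 2 < α) (hs : α - 1 / 2 ≤ s) :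
    ∀ᵐ γ ∂gaussianSequence, ∀ T : ℝ, 0 < T →
      supSobolevNorm T s (secondIterate (initialDatum α γ)) = ∞ := by
  -- The single time `0` lies in every `[-T, T]`, so one null set serves all `T`.
  filter_upwards [ae_sobolevNorm_secondIterate_eq_top hα hs 0] with γ hγ T hT
  refine top_le_iff.1 ?_
  rw [← hγ]
  exact le_iSup₂ (f := fun t (_ : t ∈ Set.Icc (-T) T) =>
    sobolevNorm s (secondIterate (initialDatum α γ) t)) 0 ⟨by linarith, hT.le⟩

end Szego

end

theorem proposition1p2 {Ω : Type*} [MeasurableSpace Ω] (P : Measure Ω) [IsProbabilityMeasure P]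
    (g : ℕ → Ω → ℂ) (hg : ∀ n, Szego.IsStdComplexGaussian (g n) P) (hind : iIndepFun g P) :
    -- for `α > 1/2` the datum and the cubic term make sense almost surely
    (∀ α : ℝ, 1 / 2 < α → ∀ᵐ ω ∂P,
      Summable (Szego.randomTerm α (fun n => g n ω)) ∧
      Integrable
        (Szego.tripleProduct (Szego.initialDatum α (fun n => g n ω))
          (Szego.initialDatum α (fun n => g n ω)) (Szego.initialDatum α (fun n => g n ω)))
        AddCircle.haarAddCircle) ∧
    -- part (a)
    (∀ α : ℝ, 1 / 2 < α → α ≤ 1 →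
      (∀ s : ℝ, α - 1 / 2 ≤ s → ∀ᵐ ω ∂P, ∀ T : ℝ, 0 < T →
        Szego.supSobolevNorm T s
          (Szego.duhamelOfData (Szego.initialDatum α (fun n => g n ω))) = ∞) ∧
      (∀ᵐ ω ∂P, ∀ T : ℝ, 0 < T →
        Szego.supSobolevNorm T (1 / 2)
          (Szego.secondIterate (Szego.initialDatum α (fun n => g n ω))) = ∞) ∧
      (∀ t : ℝ, ∀ᵐ ω ∂P,
        Szego.sobolevNorm (1 / 2)
          (Szego.secondIterate (Szego.initialDatum α (fun n => g n ω)) t) = ∞)) ∧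
    -- part (b)
    (∀ α : ℝ, 1 / 2 < α → ∀ ε : ℝ, 0 < ε → ∀ s : ℝ, s < α - 1 / 2 - ε →
      ∀ᵐ ω ∂P, ∀ T : ℝ, 0 < T →
        (∀ t ∈ Set.Icc (-T) T, Szego.MemSobolevPlus s
          (Szego.secondIterate (Szego.initialDatum α (fun n => g n ω)) t)) ∧
        Szego.supSobolevNorm T s
          (Szego.secondIterate (Szego.initialDatum α (fun n => g n ω))) < ∞) := by
  have transfer : ∀ {p : (ℕ → ℂ) → Prop}, (∀ᵐ γ ∂Szego.gaussianSequence, p γ) →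
      ∀ᵐ ω ∂P, p fun n => g n ω := fun hp => by
    rw [← Szego.map_eq_gaussianSequence hg hind] at hp
    exact ae_of_ae_map (measurable_pi_lambda _ fun n => (hg n).measurable).aemeasurable hp
  refine ⟨fun α hα => ?_, fun α hα hα1 => ⟨fun s hs => ?_, ?_, fun t => ?_⟩,
    fun α hα ε hε s hs => ?_⟩
  · obtain ⟨φ, hφ⟩ := Szego.exists_tendsto_cubicSum hα
    filter_upwards [transfer hφ] with ω hω
    exact ⟨hω.1, Szego.integrable_tripleProduct hω.2.1⟩
  · exact transfer (Szego.ae_supSobolevNorm_duhamel_eq_top hα hs)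
  -- Here `α ≤ 1` enters as `α - 1/2 ≤ 1/2`.
  · exact transfer (Szego.ae_supSobolevNorm_secondIterate_eq_top hα (by linarith))
  · exact transfer (Szego.ae_sobolevNorm_secondIterate_eq_top hα (by linarith) t)
  · filter_upwards [transfer (Szego.ae_secondIterate_bounded hα (by linarith : s < α - 1 / 2))]
      with ω hω T _ using hω T
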